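/- Let $M$ be a complex manifold, $E\to M$ a holomorphic vector bundle of finite rank, $\mathcal O_{\Lambda E}$ the sheaf of holomorphic sections of $\Lambda E$, and $\mathcal M=(M,\mathcal O_{\mathcal M})$ a complex supermanifold with associated bundle $E$. For $\mathcal O=\mathcal O_{\mathcal M}$ or $\mathcal O=\mathcal O_{\Lambda E}$ let $\mathcal O^{(t)}$ be the $t$-th power of the ideal sheaf of nilpotent elements, and let $Der^{(k)}_{\bar 0}(\mathcal O)$ be the sheaf of even derivations mapping $\mathcal O^{(t)}$ to $\mathcal O^{(t+k)}$ for all $t\ge 0$ (with $\mathcal O^{(j)}=\mathcal O$ for $j\le 0$). Put $\mathcal V^{(2)}_{\mathcal M,\bar 0}=H^0(M,Der^{(2)}_{\bar 0}(\mathcal O_{\mathcal M}))$. Let $G_E$ be the sheaf of automorphisms of the sheaf of $\mathbb Z/2$-graded algebras $\mathcal O_{\Lambda E}$ whose degree zero part is the identity. Let $\{U_i\}$ be an open cover of $M$ with isomorphisms $\varphi_i:\mathcal O_{\mathcal M}|_{U_i}\to\mathcal O_{\Lambda E}|_{U_i}$ of sheaves of $\mathbb Z/2$-graded algebras such that $\alpha_{ij}=\varphi_i\varphi_j^{-1}\in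 G_E(U_i\cap U_j)$; so $\alpha=(\alpha_{ij})$ represents the class $[\alpha]\in H^1(M,G_E)$ of $\mathcal M$. For $X\in\mathcal V^{(2)}_{\mathcal M,\bar 0}$ put $X_i=\varphi_i X|_{U_i}\varphi_i^{-1}$, so that $(X_i)\in C^0(\{U_i\},Der^{(2)}_{\bar 0}(\mathcal O_{\Lambda E}))$. A cochain $\gamma\in C^1(\{U_i\},G_E)$ is called compatible if $X_i=\gamma_{ij}X_j\gamma_{ij}^{-1}$ on $U_i\cap U_j$ for all $i,j$ and all $X\in\mathcal V^{(2)}_{\mathcal M,\bar 0}$. For $s\in\mathbb N$, $\mathcal M$ is called $2s$-nildominated if for every open $U\subset M$, every $Y\in Der^{(2)}_{\bar 0}(\mathcal O_{\mathcal M})(U)$ with $[X|_U,Y]=0$ for all $X\in\mathcal V^{(2)}_{\mathcal M,\bar 0}$ lies in $Der^{(2s)}_{\bar 0}(\mathcal O_{\mathcal M})(U)$; it is called nildominated if it is $2s$-nildominated and its odd dimension is $2s$ or $2s+1$. (1) If $\mathcal M$ is $2s$-nildominated, then it is determined up to errors of degree $2s$ and higher by its unipotent automorphisms: $\alpha$ is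 compatible, $\log\alpha_{ij}\in Der^{(2)}_{\bar 0}(\mathcal O_{\Lambda E})(U_i\cap U_j)$, and for every compatible $\gamma\in C^1(\{U_i\},G_E)$ and all $i,j$ $$\log\gamma_{ij}-\log\alpha_{ij}\in Der^{(2s)}_{\bar 0}(\mathcal O_{\Lambda E})(U_i\cap U_j).$$ (2) If $\mathcal M$ is nildominated and $H^1(M,Der^{(\mathrm{rk}E-1)}_{\bar 0}(\mathcal O_{\Lambda E}))=0$ (first Čech cohomology), then $\mathcal M$ is determined by its unipotent automorphisms: $\alpha$ is compatible, and every compatible cocycle $\gamma\in Z^1(\{U_i\},G_E)$ satisfies $[\gamma]=[\alpha]$ in $H^1(M,G_E)$. -/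

import Mathlib

open CategoryTheory TopologicalSpace Opposite Manifold ContDiff Bundle

universe u v w

/-! ## First Čech cohomology of a presheaf of groups on a topological space -/

section Cech

variable {X : TopCat.{u}}

/-- The pull-back of a 1-cocycle on the family `U` to a family `W` refining it, along a refinement
map `r`. -/
def CategoryTheory.PresheafOfGroups.OneCocycle.refine {G : (Opens X)ᵒᵖ ⥤ GrpCat.{w}}
    {ι κ : Type u} {U : ι → Opens X} (γ : PresheafOfGroups.OneCocycle G U) (W : κ → Opens X)
    (r : κ → ι) (h : ∀ k, W k ≤ U (r k)) : PresheafOfGroups.OneCocycle G W where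
  ev k l _ a b := γ.ev (r k) (r l) (a ≫ homOfLE (h k)) (b ≫ homOfLE (h l))
  ev_precomp k l _ _ φ a b := by
    rw [γ.ev_precomp]
    simp
  ev_trans k l m _ a b c := γ.ev_trans _ _ _ _ _ _

/-- A 1-cocycle with values in `G` on some open cover of `X`. -/
structure CechCocycle (G : (Opens X)ᵒᵖ ⥤ GrpCat.{w}) where
  /-- the index set of the cover -/
  ι : Type u
  /-- the cover -/
  U : ι → Opens X
  isOpenCover : IsOpenCover U
  /-- the cocycle -/
  cocycle : PresheafOfGroups.OneCocycle G U

/-- Two cocycles, on possibly different open covers, are equivalent if they become cohomologous on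
a common refinement of the covers. -/
def CechCocycle.Equivalent {G : (Opens X)ᵒᵖ ⥤ GrpCat.{w}} (c d : CechCocycle G) : Prop :=
  ∃ (κ : Type u) (W : κ → Opens X) (_ : IsOpenCover W)
    (r : κ → c.ι) (hr : ∀ k, W k ≤ c.U (r k)) (t : κ → d.ι) (ht : ∀ k, W k ≤ d.U (t k)),
    (c.cocycle.refine W r hr).IsCohomologous (d.cocycle.refine W t ht)

theorem CechCocycle.refine_isCohomologous {G : (Opens X)ᵒᵖ ⥤ GrpCat.{w}}
    {ι κ : Type u} {U : ι → Opens X} (γ : PresheafOfGroups.OneCocycle G U) (W : κ → Opens X)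
    (r t : κ → ι) (hr : ∀ k, W k ≤ U (r k)) (ht : ∀ k, W k ≤ U (t k)) :
    (γ.refine W r hr).IsCohomologous (γ.refine W t ht) := by
  refine ⟨fun k => γ.ev (t k) (r k) (homOfLE (ht k)) (homOfLE (hr k)), ?_⟩
  intro k l T a b
  change G.map a.op (γ.ev _ _ _ _) * γ.ev _ _ _ _ = γ.ev _ _ _ _ * G.map b.op (γ.ev _ _ _ _)
  rw [γ.ev_precomp, γ.ev_precomp, γ.ev_trans, γ.ev_trans]

theorem CechCocycle.isCohomologous_refine {G : (Opens X)ᵒᵖ ⥤ GrpCat.{w}}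
    {ι κ : Type u} {U : ι → Opens X} {γ δ : PresheafOfGroups.OneCocycle G U}
    (h : γ.IsCohomologous δ) (W : κ → Opens X) (r : κ → ι) (hr : ∀ k, W k ≤ U (r k)) :
    (γ.refine W r hr).IsCohomologous (δ.refine W r hr) := by
  obtain ⟨α, hα⟩ := h
  refine ⟨fun k => G.map (homOfLE (hr k)).op (α (r k)), ?_⟩
  intro k l T a b
  have := hα (r k) (r l) (a ≫ homOfLE (hr k)) (b ≫ homOfLE (hr l))
  simpa [PresheafOfGroups.OneCocycle.refine] using this

theorem CechCocycle.equivalence {G : (Opens X)ᵒᵖ ⥤ GrpCat.{w}} :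
    Equivalence (CechCocycle.Equivalent (G := G)) where
  refl c := ⟨c.ι, c.U, c.isOpenCover, id, fun _ => le_rfl, id, fun _ => le_rfl,
    (PresheafOfGroups.OneCocycle.equivalence_isCohomologous _ _).refl _⟩
  symm := by
    rintro c d ⟨κ, W, hW, r, hr, t, ht, h⟩
    exact ⟨κ, W, hW, t, ht, r, hr,
      (PresheafOfGroups.OneCocycle.equivalence_isCohomologous _ _).symm h⟩
  trans := by
    rintro c d e ⟨κ, W, hW, r, hr, t, ht, h⟩ ⟨κ', W', hW', r', hr', t', ht', h'⟩
    have E := PresheafOfGroups.OneCocycle.equivalence_isCohomologous G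
      (fun p : κ × κ' => W p.1 ⊓ W' p.2)
    refine ⟨κ × κ', fun p => W p.1 ⊓ W' p.2, ?_, fun p => r p.1,
      fun p => inf_le_left.trans (hr p.1), fun p => t' p.2,
      fun p => inf_le_right.trans (ht' p.2), ?_⟩
    · rw [IsOpenCover, eq_top_iff]
      intro x _
      obtain ⟨i, hi⟩ := hW.exists_mem x
      obtain ⟨j, hj⟩ := hW'.exists_mem x
      exact Opens.mem_iSup.2 ⟨(i, j), hi, hj⟩
    · have h1 := isCohomologous_refine h (fun p : κ × κ' => W p.1 ⊓ W' p.2) (fun p => p.1)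
        (fun p => inf_le_left)
      have h2 := isCohomologous_refine h' (fun p : κ × κ' => W p.1 ⊓ W' p.2) (fun p => p.2)
        (fun p => inf_le_right)
      have h3 := refine_isCohomologous d.cocycle (fun p : κ × κ' => W p.1 ⊓ W' p.2)
        (fun p => t p.1) (fun p => r' p.2) (fun p => inf_le_left.trans (ht p.1))
        (fun p => inf_le_right.trans (hr' p.2))
      exact E.trans h1 (E.trans h3 h2)

instance CechCocycle.setoid (G : (Opens X)ᵒᵖ ⥤ GrpCat.{w}) : Setoid (CechCocycle G) :=
  ⟨CechCocycle.Equivalent, CechCocycle.equivalence⟩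

/-- The first Čech cohomology set `H¹(X, G)` of a presheaf of (not necessarily commutative) groups:
the direct limit over all open covers of the cohomology sets of the covers. -/
def CechH1 (G : (Opens X)ᵒᵖ ⥤ GrpCat.{w}) : Type _ := Quotient (CechCocycle.setoid G)

/-- The class in `H¹(X, G)` of a cocycle on an open cover. -/
def CechH1.mk {G : (Opens X)ᵒᵖ ⥤ GrpCat.{w}} {ι : Type u} {U : ι → Opens X} (hU : IsOpenCover U)
    (γ : PresheafOfGroups.OneCocycle G U) : CechH1 G :=
  Quotient.mk (CechCocycle.setoid G) ⟨ι, U, hU, γ⟩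

end Cech

/-! ## Sheaves of superalgebras -/

/-- A sheaf of supercommutative (`ℤ/2`-graded) complex algebras on a topological space. -/
structure SuperalgebraSheaf (X : TopCat.{u}) where
  /-- the underlying sheaf of algebras -/
  sheaf : TopCat.Sheaf (AlgCat.{v} ℂ) X
  /-- the even (`0`) and odd (`1`) sections -/
  parity : ∀ U : Opens X, ZMod 2 → Submodule ℂ (sheaf.presheaf.obj (op U))
  isCompl : ∀ U, IsCompl (parity U 0) (parity U 1)
  one_mem : ∀ U, (1 : sheaf.presheaf.obj (op U)) ∈ parity U 0
  mul_mem : ∀ U i j (a b : sheaf.presheaf.obj (op U)), a ∈ parity U i → b ∈ parity U j →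
    a * b ∈ parity U (i + j)
  supercomm : ∀ U (i j : ZMod 2) (a b : sheaf.presheaf.obj (op U)),
    a ∈ parity U i → b ∈ parity U j → a * b = (-1 : ℂ) ^ (i.val * j.val) • (b * a)
  map_mem : ∀ (U V : Opens X) (h : V ≤ U) i (a : sheaf.presheaf.obj (op U)), a ∈ parity U i →
    (sheaf.presheaf.map (homOfLE h).op).hom a ∈ parity V i

namespace SuperalgebraSheaf

variable {X : TopCat.{u}} (O : SuperalgebraSheaf.{u, v} X)

/-- The algebra of sections over an open set. -/
abbrev Sec (U : Opens X) : Type v := O.sheaf.presheaf.obj (op U)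

/-- Restriction of sections. -/
def res {U V : Opens X} (h : V ≤ U) : O.Sec U →ₐ[ℂ] O.Sec V :=
  (O.sheaf.presheaf.map (homOfLE h).op).hom

@[simp]
theorem res_self {U : Opens X} (h : U ≤ U) (f : O.Sec U) : O.res h f = f := by
  simp [res]

@[simp]
theorem res_res {U V W : Opens X} (h : V ≤ U) (h' : W ≤ V) (f : O.Sec U) :
    O.res h' (O.res h f) = O.res (h'.trans h) f := by
  have : (homOfLE (h'.trans h)).op = (homOfLE h).op ≫ (homOfLE h').op := rfl
  simp [res, this]

/-- The linear span of the nilpotent sections over `U`. -/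
def nil (U : Opens X) : Submodule ℂ (O.Sec U) := Submodule.span ℂ {f | IsNilpotent f}

theorem nil_map_le {U V : Opens X} (φ : O.Sec U →ₐ[ℂ] O.Sec V) :
    (O.nil U).map φ.toLinearMap ≤ O.nil V := by
  rw [nil, Submodule.map_span_le]
  exact fun f hf => Submodule.subset_span (IsNilpotent.map (r := f) hf φ)

theorem map_mem_nil_pow {U V : Opens X} (φ : O.Sec U →ₐ[ℂ] O.Sec V) (t : ℕ) {f : O.Sec U}
    (hf : f ∈ (⊤ : Submodule ℂ (O.Sec U)) * O.nil U ^ t) :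
    φ f ∈ (⊤ : Submodule ℂ (O.Sec V)) * O.nil V ^ t := by
  have h : φ f ∈ ((⊤ : Submodule ℂ (O.Sec U)) * O.nil U ^ t).map φ.toLinearMap := ⟨f, hf, rfl⟩
  rw [Submodule.map_mul, Submodule.map_pow] at h
  exact mul_le_mul' le_top (pow_le_pow_left' (O.nil_map_le φ) t) h

/-- The `ℤ`-filtration `𝒪⁽ᵗ⁾` of the structure sheaf: a section over `U` lies in `𝒪⁽ᵗ⁾` if locally it
lies in the `t`-th power of the ideal of nilpotent elements; so `𝒪⁽⁰⁾ = 𝒪` and `𝒪⁽¹⁾` is the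
sheaf of nilpotent elements. -/
def filtration (t : ℕ) (U : Opens X) : Submodule ℂ (O.Sec U) where
  carrier := {f | ∀ x ∈ U, ∃ (V : Opens X) (h : V ≤ U), x ∈ V ∧
    O.res h f ∈ (⊤ : Submodule ℂ (O.Sec V)) * O.nil V ^ t}
  zero_mem' x hx := ⟨U, le_rfl, hx, by simp⟩
  add_mem' := by
    intro f g hf hg x hx
    obtain ⟨V, hV, hxV, hfV⟩ := hf x hx
    obtain ⟨W, hW, hxW, hgW⟩ := hg x hx
    refine ⟨V ⊓ W, inf_le_left.trans hV, ⟨hxV, hxW⟩, ?_⟩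
    rw [map_add]
    refine Submodule.add_mem _ ?_ ?_
    · have := O.map_mem_nil_pow (O.res (inf_le_left : V ⊓ W ≤ V)) t hfV
      simpa using this
    · have := O.map_mem_nil_pow (O.res (inf_le_right : V ⊓ W ≤ W)) t hgW
      simpa using this
  smul_mem' := by
    intro c f hf x hx
    obtain ⟨V, hV, hxV, hfV⟩ := hf x hx
    exact ⟨V, hV, hxV, by rw [map_smul]; exact Submodule.smul_mem _ _ hfV⟩

theorem filtration_antitone {s t : ℕ} (h : s ≤ t) (U : Opens X) :
    O.filtration t U ≤ O.filtration s U := by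
  intro f hf x hx
  obtain ⟨V, hV, hxV, hfV⟩ := hf x hx
  refine ⟨V, hV, hxV, ?_⟩
  obtain ⟨k, rfl⟩ := Nat.exists_eq_add_of_le' h
  rw [pow_add, ← mul_assoc] at hfV
  exact (mul_le_mul' le_top le_rfl : _ ≤ (⊤ : Submodule ℂ (O.Sec V)) * O.nil V ^ s) hfV

/-- The algebra `End(𝒪)(U)` of `ℂ`-linear endomorphisms of the sheaf `𝒪|_U`. -/
def End (U : Opens X) : Subalgebra ℂ (∀ V : {V : Opens X // V ≤ U}, Module.End ℂ (O.Sec V)) where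
  carrier := {φ | ∀ (V W : {V : Opens X // V ≤ U}) (h : W.1 ≤ V.1) (f : O.Sec V),
    O.res h (φ V f) = φ W (O.res h f)}
  mul_mem' := by
    intro φ ψ hφ hψ V W h f
    simp [hφ V W h, hψ V W h]
  add_mem' := by
    intro φ ψ hφ hψ V W h f
    simp [hφ V W h, hψ V W h]
  algebraMap_mem' := by
    intro c V W h f
    simp [Module.algebraMap_end_apply]

noncomputable instance (U : Opens X) : Ring (O.End U) := Subalgebra.toRing _

noncomputable instance (U : Opens X) : AddCommGroup (O.End U) := Ring.toAddCommGroup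

noncomputable instance (U : Opens X) : Module ℂ (O.End U) := Algebra.toModule

/-- Restriction of endomorphisms to a smaller open set. -/
def endRes {U V : Opens X} (h : V ≤ U) : O.End U →ₐ[ℂ] O.End V where
  toFun φ := ⟨fun W => φ.1 ⟨W.1, W.2.trans h⟩,
    fun W W' h' f => φ.2 ⟨W.1, W.2.trans h⟩ ⟨W'.1, W'.2.trans h⟩ h' f⟩
  map_one' := rfl
  map_mul' _ _ := rfl
  map_zero' := rfl
  map_add' _ _ := rfl
  commutes' _ := rfl

variable {O} in
/-- An endomorphism is even if it preserves the parity of sections. -/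
def IsEven {U : Opens X} (φ : O.End U) : Prop :=
  ∀ (V : {V : Opens X // V ≤ U}) (i : ZMod 2) (f : O.Sec V), f ∈ O.parity V i →
    φ.1 V f ∈ O.parity V i

variable {O} in
/-- An endomorphism lies in `End⁽ᵏ⁾(𝒪)(U)` if it maps `𝒪⁽ᵗ⁾` to `𝒪⁽ᵗ⁺ᵏ⁾` for all `t`, where
`𝒪⁽ʲ⁾ = 𝒪` for `j ≤ 0`. -/
def IsFiltered {U : Opens X} (k : ℤ) (φ : O.End U) : Prop :=
  ∀ (V : {V : Opens X // V ≤ U}) (t : ℕ) (f : O.Sec V), f ∈ O.filtration t V →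
    φ.1 V f ∈ O.filtration (t + k).toNat V

/-- The space `Der⁽ᵏ⁾_0̄(𝒪)(U)` of even derivations of the sheaf `𝒪|_U` that raise the degree in the
filtration by at least `k`. (For an even derivation there is no sign in the Leibniz rule.) -/
def evenDer (k : ℤ) (U : Opens X) : Submodule ℂ (O.End U) where
  carrier := {D | (∀ (V : {V : Opens X // V ≤ U}) (f g : O.Sec V),
    D.1 V (f * g) = D.1 V f * g + f * D.1 V g) ∧ IsEven D ∧ IsFiltered k D}
  zero_mem' := ⟨by simp, fun V i f _ => Submodule.zero_mem _, fun V t f _ => Submodule.zero_mem _⟩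
  add_mem' := by
    rintro D D' ⟨h1, h2, h3⟩ ⟨h1', h2', h3'⟩
    refine ⟨fun V f g => ?_, fun V i f hf => Submodule.add_mem _ (h2 V i f hf) (h2' V i f hf),
      fun V t f hf => Submodule.add_mem _ (h3 V t f hf) (h3' V t f hf)⟩
    change D.1 V (f * g) + D'.1 V (f * g) =
      (D.1 V f + D'.1 V f) * g + f * (D.1 V g + D'.1 V g)
    rw [h1, h1']
    noncomm_ring
  smul_mem' := by
    rintro c D ⟨h1, h2, h3⟩
    refine ⟨fun V f g => ?_, fun V i f hf => Submodule.smul_mem _ _ (h2 V i f hf),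
      fun V t f hf => Submodule.smul_mem _ _ (h3 V t f hf)⟩
    change c • D.1 V (f * g) = (c • D.1 V f) * g + f * (c • D.1 V g)
    rw [h1]
    simp

noncomputable instance (k : ℤ) (U : Opens X) : AddCommGroup (O.evenDer k U) :=
  Submodule.addCommGroup _

theorem endRes_mem_evenDer {k : ℤ} {U V : Opens X} (h : V ≤ U) {D : O.End U}
    (hD : D ∈ O.evenDer k U) : O.endRes h D ∈ O.evenDer k V :=
  ⟨fun V => hD.1 ⟨V.1, V.2.trans h⟩, fun V => hD.2.1 ⟨V.1, V.2.trans h⟩,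
    fun V => hD.2.2 ⟨V.1, V.2.trans h⟩⟩

/-- The sheaf `Der⁽ᵏ⁾_0̄(𝒪)`, as a presheaf of (multiplicatively written) abelian groups. -/
noncomputable def derPresheaf (k : ℤ) : (Opens X)ᵒᵖ ⥤ GrpCat where
  obj U := GrpCat.of (Multiplicative (O.evenDer k U.unop))
  map {U V} i := GrpCat.ofHom (AddMonoidHom.toMultiplicative
    (((O.endRes i.unop.le).toLinearMap.restrict (p := O.evenDer k U.unop)
      (q := O.evenDer k V.unop) (fun _ hD => O.endRes_mem_evenDer i.unop.le hD)).toAddMonoidHom))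
  map_id _ := rfl
  map_comp _ _ := rfl

theorem filtration_map_of_mul {U : Opens X} (g : O.End U)
    (h1 : ∀ V, g.1 V 1 = 1) (hmul : ∀ V f f', g.1 V (f * f') = g.1 V f * g.1 V f')
    (V : {V : Opens X // V ≤ U}) (t : ℕ) (f : O.Sec V) (hf : f ∈ O.filtration t V) :
    g.1 V f ∈ O.filtration t V := by
  intro x hx
  obtain ⟨W, hW, hxW, hfW⟩ := hf x hx
  refine ⟨W, hW, hxW, ?_⟩
  rw [g.2 V ⟨W, hW.trans V.2⟩ hW f]
  exact O.map_mem_nil_pow (AlgHom.ofLinearMap (g.1 ⟨W, hW.trans V.2⟩) (h1 _) (hmul _)) t hfW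

theorem unit_apply_inv {U : Opens X} (g : (O.End U)ˣ) (V : {V : Opens X // V ≤ U}) (f : O.Sec V) :
    g.1.1 V ((g⁻¹).1.1 V f) = f := by
  have h : g.1 * (g⁻¹).1 = 1 := by rw [← Units.val_mul]; simp
  exact congrArg (fun φ : O.End U => φ.1 V f) h

theorem unit_inv_apply {U : Opens X} (g : (O.End U)ˣ) (V : {V : Opens X // V ≤ U}) (f : O.Sec V) :
    (g⁻¹).1.1 V (g.1.1 V f) = f := by
  have h : (g⁻¹).1 * g.1 = 1 := by rw [← Units.val_mul]; simp
  exact congrArg (fun φ : O.End U => φ.1 V f) h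

/-- The group of automorphisms of the sheaf of `ℤ/2`-graded algebras `𝒪|_U` that induce the identity
on the graded sheaf `⨁ₜ 𝒪⁽ᵗ⁾/𝒪⁽ᵗ⁺¹⁾`. For the sheaf of sections of an exterior bundle `ΛE`,
this says that their degree zero part is the identity, and the group is `G_E(U)`. -/
def unipotent (U : Opens X) : Subgroup (O.End U)ˣ where
  carrier := {g | (∀ V, g.1.1 V 1 = 1) ∧
    (∀ (V : {V : Opens X // V ≤ U}) (f f' : O.Sec V),
      g.1.1 V (f * f') = g.1.1 V f * g.1.1 V f') ∧
    IsEven g.1 ∧ IsFiltered 1 (g.1 - 1)}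
  one_mem' := by
    refine ⟨fun _ => rfl, fun _ _ _ => rfl, fun _ _ _ hf => hf, fun V t f _ => ?_⟩
    have : ((1 : (O.End U)ˣ).1 - 1 : O.End U) = 0 := sub_self _
    rw [this]
    exact Submodule.zero_mem _
  mul_mem' := by
    rintro g h ⟨g1, g2, g3, g4⟩ ⟨h1, h2, h3, h4⟩
    refine ⟨fun V => ?_, fun V f f' => ?_, fun V i f hf => g3 V i _ (h3 V i f hf),
      fun V t f hf => ?_⟩
    · change g.1.1 V (h.1.1 V 1) = 1
      rw [h1, g1]
    · change g.1.1 V (h.1.1 V _) = g.1.1 V (h.1.1 V _) * g.1.1 V (h.1.1 V _)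
      rw [h2, g2]
    · have e : ((g * h).1 - 1 : O.End U).1 V f =
          (g.1 - 1 : O.End U).1 V (h.1.1 V f) + (h.1 - 1 : O.End U).1 V f := by
        change g.1.1 V (h.1.1 V f) - f = (g.1.1 V (h.1.1 V f) - h.1.1 V f) + (h.1.1 V f - f)
        abel
      rw [e]
      exact Submodule.add_mem _ (g4 V t _ (O.filtration_map_of_mul h.1 h1 h2 V t f hf))
        (h4 V t f hf)
  inv_mem' := by
    rintro g ⟨g1, g2, g3, g4⟩
    have i1 : ∀ V, (g⁻¹).1.1 V 1 = 1 := fun V => by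
      conv_lhs => rw [← g1 V]
      exact O.unit_inv_apply g V 1
    have i2 : ∀ (V : {V : Opens X // V ≤ U}) (f f' : O.Sec V),
        (g⁻¹).1.1 V (f * f') = (g⁻¹).1.1 V f * (g⁻¹).1.1 V f' := fun V f f' => by
      conv_lhs => rw [← O.unit_apply_inv g V f, ← O.unit_apply_inv g V f', ← g2]
      exact O.unit_inv_apply g V _
    have key : ∀ (V : {V : Opens X // V ≤ U}) (i j : ZMod 2), IsCompl (O.parity V i)
        (O.parity V j) → ∀ f ∈ O.parity V i, (g⁻¹).1.1 V f ∈ O.parity V i := by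
      intro V i j hij f hf
      obtain ⟨a, ha, b, hb, hab⟩ :=
        Submodule.mem_sup.1 (hij.sup_eq_top ▸ Submodule.mem_top : (g⁻¹).1.1 V f ∈ _ ⊔ _)
      have hf' : g.1.1 V a + g.1.1 V b = f := by
        rw [← map_add, hab]
        exact O.unit_apply_inv g V f
      have hgb : g.1.1 V b = 0 := by
        have hm : g.1.1 V b ∈ O.parity V i := by
          rw [← eq_sub_iff_add_eq'] at hf'
          rw [hf']
          exact Submodule.sub_mem _ hf (g3 V i a ha)
        exact Submodule.disjoint_def.1 hij.disjoint _ hm (g3 V j b hb)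
      have hb0 : b = 0 := by
        rw [← O.unit_inv_apply g V b, hgb, map_zero]
      rw [← hab, hb0, add_zero]
      exact ha
    refine ⟨i1, i2, fun V i => ?_, fun V t f hf => ?_⟩
    · fin_cases i
      · exact key V 0 1 (O.isCompl _)
      · exact key V 1 0 (O.isCompl _).symm
    · have e : ((g⁻¹).1 - 1 : O.End U).1 V f = -(g.1 - 1 : O.End U).1 V ((g⁻¹).1.1 V f) := by
        change (g⁻¹).1.1 V f - f = -(g.1.1 V ((g⁻¹).1.1 V f) - (g⁻¹).1.1 V f)
        rw [O.unit_apply_inv]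
        abel
      rw [e]
      exact Submodule.neg_mem _ (g4 V t _ (O.filtration_map_of_mul (g⁻¹).1 i1 i2 V t f hf))

/-- Restriction of units of the endomorphism sheaf. -/
def unitsRes {U V : Opens X} (h : V ≤ U) : (O.End U)ˣ →* (O.End V)ˣ :=
  Units.map (O.endRes h : O.End U →* O.End V)

theorem unitsRes_mem {U V : Opens X} (h : V ≤ U) {g : (O.End U)ˣ} (hg : g ∈ O.unipotent U) :
    O.unitsRes h g ∈ O.unipotent V :=
  ⟨fun V => hg.1 ⟨V.1, V.2.trans h⟩, fun V => hg.2.1 ⟨V.1, V.2.trans h⟩,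
    fun V => hg.2.2.1 ⟨V.1, V.2.trans h⟩, fun V => hg.2.2.2 ⟨V.1, V.2.trans h⟩⟩

/-- The sheaf of groups `U ↦ unipotent U`; for the sections of an exterior bundle `ΛE` this is
`G_E`. -/
noncomputable def unipotentPresheaf : (Opens X)ᵒᵖ ⥤ GrpCat where
  obj U := GrpCat.of (O.unipotent U.unop)
  map {U V} i := GrpCat.ofHom (((O.unitsRes i.unop.le).comp (O.unipotent U.unop).subtype).codRestrict
    (O.unipotent V.unop) (fun g => O.unitsRes_mem i.unop.le g.2))
  map_id _ := rfl
  map_comp _ _ := rfl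

/-- The logarithm `∑ₙ (-1)ⁿ/(n+1) (g - 1)ⁿ⁺¹` of an endomorphism `g` with `g - 1` nilpotent. -/
noncomputable def log {U : Opens X} (g : O.End U) : O.End U :=
  ∑ n ∈ Finset.range (nilpotencyClass (g - 1)), ((-1 : ℂ) ^ n / (n + 1 : ℂ)) • (g - 1) ^ (n + 1)

/-- `𝒪` is `k`-nildominated: over every open `U`, an even derivation of degree at least two which
commutes with all global even derivations of degree at least two has degree at least `k`. -/
def IsNildominatedInDegree (k : ℕ) : Prop :=
  ∀ (U : Opens X), ∀ Y ∈ O.evenDer 2 U,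
    (∀ D ∈ O.evenDer 2 ⊤, ⁅O.endRes (le_top : U ≤ ⊤) D, Y⁆ = 0) → Y ∈ O.evenDer k U

end SuperalgebraSheaf

/-- An isomorphism over the open set `U` of sheaves of `ℤ/2`-graded algebras. -/
structure LocalIso {X : TopCat.{u}} (O : SuperalgebraSheaf.{u, v} X)
    (O' : SuperalgebraSheaf.{u, w} X) (U : Opens X) where
  /-- the isomorphisms on sections -/
  equiv : ∀ V : {V : Opens X // V ≤ U}, O.Sec V ≃ₐ[ℂ] O'.Sec V
  natural : ∀ (V W : {V : Opens X // V ≤ U}) (h : W.1 ≤ V.1) (f : O.Sec V),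
    O'.res h (equiv V f) = equiv W (O.res h f)
  parity : ∀ (V : {V : Opens X // V ≤ U}) (i : ZMod 2) (f : O.Sec V), f ∈ O.parity V i →
    equiv V f ∈ O'.parity V i

namespace LocalIso

variable {X : TopCat.{u}} {O : SuperalgebraSheaf.{u, v} X} {O' : SuperalgebraSheaf.{u, w} X}

theorem natural_symm {U : Opens X} (φ : LocalIso O O' U) (V W : {V : Opens X // V ≤ U})
    (h : W.1 ≤ V.1) (f : O'.Sec V) :
    O.res h ((φ.equiv V).symm f) = (φ.equiv W).symm (O'.res h f) := by
  rw [AlgEquiv.eq_symm_apply, ← φ.natural V W h]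
  simp

/-- Transport `φ ∘ D ∘ φ⁻¹` of an endomorphism of `𝒪|_T` along a local isomorphism `φ`. -/
def conj {U T : Opens X} (φ : LocalIso O O' U) (h : T ≤ U) (D : O.End T) : O'.End T :=
  ⟨fun V => (φ.equiv ⟨V.1, V.2.trans h⟩).toLinearMap ∘ₗ D.1 V ∘ₗ
      (φ.equiv ⟨V.1, V.2.trans h⟩).symm.toLinearMap, by
    intro V W hVW f
    have h1 := φ.natural ⟨V.1, V.2.trans h⟩ ⟨W.1, W.2.trans h⟩ hVW
    have h2 := φ.natural_symm ⟨V.1, V.2.trans h⟩ ⟨W.1, W.2.trans h⟩ hVW f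
    have h3 := D.2 V W hVW
    simp only [LinearMap.comp_apply, AlgEquiv.toLinearMap_apply]
    rw [h1, h3, h2]⟩

/-- The composite `φ ∘ ψ⁻¹` of two local isomorphisms, as an invertible endomorphism. -/
def transition {U U' T : Opens X} (φ : LocalIso O O' U) (ψ : LocalIso O O' U') (h : T ≤ U)
    (h' : T ≤ U') : (O'.End T)ˣ where
  val := ⟨fun V => (φ.equiv ⟨V.1, V.2.trans h⟩).toLinearMap ∘ₗ
      (ψ.equiv ⟨V.1, V.2.trans h'⟩).symm.toLinearMap, by
    intro V W hVW f
    have h1 := φ.natural ⟨V.1, V.2.trans h⟩ ⟨W.1, W.2.trans h⟩ hVW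
    have h2 := ψ.natural_symm ⟨V.1, V.2.trans h'⟩ ⟨W.1, W.2.trans h'⟩ hVW f
    simp only [LinearMap.comp_apply, AlgEquiv.toLinearMap_apply]
    rw [h1, h2]⟩
  inv := ⟨fun V => (ψ.equiv ⟨V.1, V.2.trans h'⟩).toLinearMap ∘ₗ
      (φ.equiv ⟨V.1, V.2.trans h⟩).symm.toLinearMap, by
    intro V W hVW f
    have h1 := ψ.natural ⟨V.1, V.2.trans h'⟩ ⟨W.1, W.2.trans h'⟩ hVW
    have h2 := φ.natural_symm ⟨V.1, V.2.trans h⟩ ⟨W.1, W.2.trans h⟩ hVW f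
    simp only [LinearMap.comp_apply, AlgEquiv.toLinearMap_apply]
    rw [h1, h2]⟩
  val_inv := by
    refine Subtype.ext (funext fun V => LinearMap.ext fun f => ?_)
    change φ.equiv ⟨V.1, _⟩ ((ψ.equiv ⟨V.1, _⟩).symm (ψ.equiv ⟨V.1, _⟩
      ((φ.equiv ⟨V.1, _⟩).symm f))) = f
    rw [AlgEquiv.symm_apply_apply, AlgEquiv.apply_symm_apply]
  inv_val := by
    refine Subtype.ext (funext fun V => LinearMap.ext fun f => ?_)
    change ψ.equiv ⟨V.1, _⟩ ((φ.equiv ⟨V.1, _⟩).symm (φ.equiv ⟨V.1, _⟩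
      ((ψ.equiv ⟨V.1, _⟩).symm f))) = f
    rw [AlgEquiv.symm_apply_apply, AlgEquiv.apply_symm_apply]

end LocalIso

/-! ## Representing a sheaf of superalgebras by a cocycle -/

/-- A system of local isomorphisms `φᵢ : 𝒪|_{Uᵢ} ≅ 𝒪'|_{Uᵢ}` over an open cover whose transition maps
`φᵢ ∘ φⱼ⁻¹` induce the identity on the graded sheaf of `𝒪'`. In particular the `φᵢ` induce one and
the same isomorphism of the graded sheaves of `𝒪` and `𝒪'` on overlaps. For `𝒪'` the sheaf of
sections of an exterior bundle `ΛE` this exhibits `E` as the bundle associated with `𝒪`, and `𝒪` as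
glued by a cocycle with values in `G_E`. -/
structure SplittingAtlas {X : TopCat.{u}} (O : SuperalgebraSheaf.{u, v} X)
    (O' : SuperalgebraSheaf.{u, w} X) where
  /-- the index set of the cover -/
  ι : Type u
  /-- the cover -/
  U : ι → Opens X
  isOpenCover : IsOpenCover U
  /-- the local isomorphisms -/
  chart : ∀ i, LocalIso O O' (U i)
  transition_mem : ∀ i j, (chart i).transition (chart j) (inf_le_left : U i ⊓ U j ≤ U i)
    inf_le_right ∈ O'.unipotent (U i ⊓ U j)

namespace SplittingAtlas

variable {X : TopCat.{u}} {O : SuperalgebraSheaf.{u, v} X} {O' : SuperalgebraSheaf.{u, w} X}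
  (A : SplittingAtlas O O')

/-- The cocycle `αᵢⱼ = φᵢ ∘ φⱼ⁻¹` representing `𝒪`. -/
noncomputable def cocycle : PresheafOfGroups.OneCocycle O'.unipotentPresheaf A.U where
  ev i j _ a b := ⟨(A.chart i).transition (A.chart j) a.le b.le,
    O'.unitsRes_mem (le_inf a.le b.le) (A.transition_mem i j)⟩
  ev_precomp _ _ _ _ _ _ _ := rfl
  ev_trans i j k T a b c := by
    refine Subtype.ext (Units.ext (Subtype.ext (funext fun V => LinearMap.ext fun f => ?_)))
    change (A.chart i).equiv ⟨V.1, _⟩ (((A.chart j).equiv ⟨V.1, _⟩).symm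
      ((A.chart j).equiv ⟨V.1, _⟩ (((A.chart k).equiv ⟨V.1, _⟩).symm f))) =
      (A.chart i).equiv ⟨V.1, _⟩ (((A.chart k).equiv ⟨V.1, _⟩).symm f)
    rw [AlgEquiv.symm_apply_apply]

/-- The class in `H¹(X, G)` of the cocycle of the atlas. -/
noncomputable def cechClass : CechH1 O'.unipotentPresheaf := CechH1.mk A.isOpenCover A.cocycle

/-- The value on `Uᵢ ∩ Uⱼ` of a 1-cochain, as an invertible endomorphism. -/
noncomputable def value (γ : PresheafOfGroups.OneCochain O'.unipotentPresheaf A.U) (i j : A.ι) :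
    (O'.End (A.U i ⊓ A.U j))ˣ :=
  (γ.ev i j (homOfLE inf_le_left) (homOfLE inf_le_right) : O'.unipotent (A.U i ⊓ A.U j)).1

/-- The 0-cochain `Dᵢ = φᵢ ∘ D|_{Uᵢ} ∘ φᵢ⁻¹` of endomorphisms of `𝒪'` given by a global endomorphism
`D` of `𝒪`. -/
noncomputable def component (D : O.End ⊤) (i : A.ι) : O'.End (A.U i) :=
  (A.chart i).conj le_rfl (O.endRes le_top D)

/-- The conditions `Xᵢ = γᵢⱼ Xⱼ γᵢⱼ⁻¹` on `Uᵢ ∩ Uⱼ`, for `X` running through the global even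
derivations of `𝒪` of degree at least two. -/
def IsCompatible (γ : PresheafOfGroups.OneCochain O'.unipotentPresheaf A.U) : Prop :=
  ∀ D ∈ O.evenDer 2 ⊤, ∀ i j, O'.endRes inf_le_left (A.component D i) =
    (A.value γ i j).1 * O'.endRes inf_le_right (A.component D j) * ((A.value γ i j)⁻¹).1

/-- The conditions `Xᵢ = γᵢⱼ Xⱼ γᵢⱼ⁻¹`, which hold for the cocycle `α` of the atlas, determine
`u = log α` as a 1-cochain of even derivations of degree at least two up to terms in
`C¹(Der⁽ᵏ⁾_0̄(𝒪'))`. -/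
def IsDeterminedUpTo (k : ℕ) : Prop :=
  A.IsCompatible A.cocycle.toOneCochain ∧
  (∀ i j, O'.log (A.value A.cocycle.toOneCochain i j).1 ∈ O'.evenDer 2 (A.U i ⊓ A.U j)) ∧
  ∀ γ : PresheafOfGroups.OneCochain O'.unipotentPresheaf A.U, A.IsCompatible γ →
    ∀ i j, O'.log (A.value γ i j).1 - O'.log (A.value A.cocycle.toOneCochain i j).1 ∈
      O'.evenDer k (A.U i ⊓ A.U j)

/-- The conditions `Xᵢ = γᵢⱼ Xⱼ γᵢⱼ⁻¹`, which hold for the cocycle `α` of the atlas, determine the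
class of `α` in `H¹`: every cocycle `γ` satisfying them has the same class. -/
def IsDetermined : Prop :=
  A.IsCompatible A.cocycle.toOneCochain ∧
  ∀ γ : PresheafOfGroups.OneCocycle O'.unipotentPresheaf A.U, A.IsCompatible γ.toOneCochain →
    CechH1.mk A.isOpenCover γ = A.cechClass

end SplittingAtlas

/-! ## The sheaf of sections of an exterior bundle, and complex supermanifolds -/

section Exterior

variable (B : Type*) [NormedAddCommGroup B] [NormedSpace ℂ B]
  {M : Type u} [TopologicalSpace M] [ChartedSpace B M]
  (F : Type*) [NormedAddCommGroup F] [NormedSpace ℂ F]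
  (E : M → Type v) [TopologicalSpace (TotalSpace F E)] [∀ x, AddCommGroup (E x)]
  [∀ x, Module ℂ (E x)] [∀ x, TopologicalSpace (E x)] [FiberBundle F E]

/-- The fibrewise exterior algebra over `U`: all (set-theoretic) sections of `ΛE`. -/
abbrev AllSections (U : Opens M) : Type (max u v) := ∀ x : U, ExteriorAlgebra ℂ (E x)

/-- Restriction of set-theoretic sections of `ΛE`. -/
def AllSections.res {U V : Opens M} (h : V ≤ U) : AllSections E U →ₐ[ℂ] AllSections E V where
  toFun s x := s ⟨x.1, h x.2⟩
  map_one' := rfl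
  map_mul' _ _ := rfl
  map_zero' := rfl
  map_add' _ _ := rfl
  commutes' _ := rfl

/-- The holomorphic functions on `V`, as sections of `Λ⁰E`, and the holomorphic sections of `E`
over `V`, as sections of `Λ¹E`. -/
def exteriorGenerators (V : Opens M) : Set (AllSections E V) :=
  {s | ∃ f : M → ℂ, ContMDiffOn 𝓘(ℂ, B) 𝓘(ℂ) ω f V ∧
    s = fun x : V => algebraMap ℂ (ExteriorAlgebra ℂ (E x)) (f x)} ∪
  {s | ∃ σ : ∀ x, E x, ContMDiffOn 𝓘(ℂ, B) (𝓘(ℂ, B).prod 𝓘(ℂ, F)) ω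
      (fun x => (⟨x, σ x⟩ : TotalSpace F E)) V ∧
    s = fun x : V => ExteriorAlgebra.ι ℂ (σ x)}

theorem res_mem_adjoin {U V : Opens M} (h : V ≤ U) {s : AllSections E U}
    (hs : s ∈ Algebra.adjoin ℂ (exteriorGenerators B F E U)) :
    AllSections.res E h s ∈ Algebra.adjoin ℂ (exteriorGenerators B F E V) := by
  have key : Algebra.adjoin ℂ (exteriorGenerators B F E U) ≤
      (Algebra.adjoin ℂ (exteriorGenerators B F E V)).comap (AllSections.res E h) := by
    refine Algebra.adjoin_le ?_
    rintro s (⟨f, hf, rfl⟩ | ⟨σ, hσ, rfl⟩)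
    · exact Algebra.subset_adjoin (Or.inl ⟨f, hf.mono h, rfl⟩)
    · exact Algebra.subset_adjoin (Or.inr ⟨σ, hσ.mono h, rfl⟩)
  exact key hs

/-- The algebra of holomorphic sections of `ΛE` over `U`: the sections that are locally finite sums
of exterior products of holomorphic functions and holomorphic sections of `E`. -/
def exteriorSections (U : Opens M) : Subalgebra ℂ (AllSections E U) where
  carrier := {s | ∀ x ∈ U, ∃ (V : Opens M) (h : V ≤ U), x ∈ V ∧
    AllSections.res E h s ∈ Algebra.adjoin ℂ (exteriorGenerators B F E V)}
  mul_mem' := by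
    intro s t hs ht x hx
    obtain ⟨V, hV, hxV, hsV⟩ := hs x hx
    obtain ⟨W, hW, hxW, htW⟩ := ht x hx
    refine ⟨V ⊓ W, inf_le_left.trans hV, ⟨hxV, hxW⟩, ?_⟩
    rw [map_mul]
    exact mul_mem (res_mem_adjoin B F E (inf_le_left : V ⊓ W ≤ V) hsV)
      (res_mem_adjoin B F E (inf_le_right : V ⊓ W ≤ W) htW)
  add_mem' := by
    intro s t hs ht x hx
    obtain ⟨V, hV, hxV, hsV⟩ := hs x hx
    obtain ⟨W, hW, hxW, htW⟩ := ht x hx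
    refine ⟨V ⊓ W, inf_le_left.trans hV, ⟨hxV, hxW⟩, ?_⟩
    rw [map_add]
    exact add_mem (res_mem_adjoin B F E (inf_le_left : V ⊓ W ≤ V) hsV)
      (res_mem_adjoin B F E (inf_le_right : V ⊓ W ≤ W) htW)
  algebraMap_mem' c x hx := ⟨U, le_rfl, hx, by
    rw [AlgHom.commutes]
    exact Subalgebra.algebraMap_mem _ c⟩

theorem res_mem_exteriorSections {U V : Opens M} (h : V ≤ U) {s : AllSections E U}
    (hs : s ∈ exteriorSections B F E U) :
    AllSections.res E h s ∈ exteriorSections B F E V := by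
  intro x hx
  obtain ⟨W, hW, hxW, hsW⟩ := hs x (h hx)
  exact ⟨V ⊓ W, inf_le_left, ⟨hx, hxW⟩, res_mem_adjoin B F E (inf_le_right : V ⊓ W ≤ W) hsW⟩

/-- The presheaf of holomorphic sections of `ΛE`. -/
noncomputable def exteriorPresheaf : TopCat.Presheaf (AlgCat.{max u v} ℂ) (TopCat.of M) where
  obj U := AlgCat.of ℂ (exteriorSections B F E U.unop)
  map {U V} i := AlgCat.ofHom (((AllSections.res E i.unop.le).comp
    (exteriorSections B F E U.unop).val).codRestrict (exteriorSections B F E V.unop)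
      (fun s => res_mem_exteriorSections B F E i.unop.le s.2))
  map_id _ := rfl
  map_comp _ _ := rfl

theorem exteriorPresheaf_isSheaf : (exteriorPresheaf B F E).IsSheaf := by
  have : Limits.HasLimitsOfSize.{u, u} (AlgCat.{max u v} ℂ) := AlgCat.hasLimitsOfSize.{u, max u v, 0, u}
  rw [TopCat.Presheaf.isSheaf_iff_isSheafUniqueGluing]
  intro ι U sf hsf
  replace hsf : ∀ i j, ∀ x : M, ∀ (hi : x ∈ U i) (hj : x ∈ U j),
      (sf i).1 ⟨x, hi⟩ = (sf j).1 ⟨x, hj⟩ := fun i j x hi hj =>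
    congrFun (congrArg Subtype.val (hsf i j)) ⟨x, hi, hj⟩
  have hU : ∀ x : (iSup U : Opens M), ∃ i, x.1 ∈ U i := fun x => Opens.mem_iSup.1 x.2
  choose k hk using hU
  let s : AllSections E (iSup U : Opens M) := fun x => (sf (k x)).1 ⟨x.1, hk x⟩
  have hs : s ∈ exteriorSections B F E (iSup U : Opens M) := by
    intro x hx
    obtain ⟨V, hV, hxV, hsV⟩ := (sf (k ⟨x, hx⟩)).2 x (hk ⟨x, hx⟩)
    refine ⟨V, hV.trans (le_iSup U _), hxV, ?_⟩
    convert hsV using 1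
    funext y
    exact hsf _ _ _ _ _
  refine ⟨⟨s, hs⟩, fun i => ?_, fun t ht => ?_⟩
  · exact Subtype.ext (funext fun x => hsf _ _ _ _ _)
  · refine Subtype.ext (funext fun x => ?_)
    exact congrFun (congrArg Subtype.val (ht (k x))) ⟨x.1, hk x⟩

/-- The parity involution of the sections of `ΛE`. -/
noncomputable def AllSections.involute (U : Opens M) : AllSections E U →ₐ[ℂ] AllSections E U :=
  AlgHom.pi fun x => (CliffordAlgebra.involute (Q := (0 : QuadraticForm ℂ (E x)))).comp
    (Pi.evalAlgHom ℂ _ x)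

theorem involute_mem_exteriorSections {U : Opens M} {s : AllSections E U}
    (hs : s ∈ exteriorSections B F E U) :
    AllSections.involute E U s ∈ exteriorSections B F E U := by
  intro x hx
  obtain ⟨V, hV, hxV, hsV⟩ := hs x hx
  refine ⟨V, hV, hxV, ?_⟩
  have key : Algebra.adjoin ℂ (exteriorGenerators B F E V) ≤
      (Algebra.adjoin ℂ (exteriorGenerators B F E V)).comap (AllSections.involute E V) := by
    refine Algebra.adjoin_le ?_
    rintro s (⟨f, hf, rfl⟩ | ⟨σ, hσ, rfl⟩)
    · refine Algebra.subset_adjoin (Or.inl ⟨f, hf, funext fun x => ?_⟩)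
      exact AlgHom.commutes _ _
    · have h : AllSections.involute E V (fun x : V => ExteriorAlgebra.ι ℂ (σ x)) =
          -(fun x : V => ExteriorAlgebra.ι ℂ (σ x)) :=
        funext fun x => CliffordAlgebra.involute_ι _
      change AllSections.involute E V _ ∈ Algebra.adjoin ℂ (exteriorGenerators B F E V)
      rw [h]
      exact neg_mem (Algebra.subset_adjoin (Or.inr ⟨σ, hσ, rfl⟩))
  exact key hsV

theorem neg_one_pow_parity_smul {A : Type*} [AddCommGroup A] [Module ℂ A] (i j : ZMod 2) (a : A) :
    (-1 : ℤˣ) ^ (j * i) • a = (-1 : ℂ) ^ (i.val * j.val) • a := by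
  have h : ∀ i : ZMod 2, i = 0 ∨ i = 1 := by decide
  rcases h i with rfl | rfl <;> rcases h j with rfl | rfl <;> simp [ZMod.val_one]

/-- The sheaf `𝒪_{ΛE}` of holomorphic sections of the exterior bundle `ΛE`, with its parity. -/
noncomputable def exteriorSheaf : SuperalgebraSheaf.{u, max u v} (TopCat.of M) where
  sheaf := ⟨exteriorPresheaf B F E, exteriorPresheaf_isSheaf B F E⟩
  parity U i := (Submodule.pi Set.univ fun x : U =>
    CliffordAlgebra.evenOdd (0 : QuadraticForm ℂ (E x.1)) i).comap
      (exteriorSections B F E U).val.toLinearMap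
  isCompl U := by
    rw [isCompl_iff, Submodule.disjoint_def, codisjoint_iff, eq_top_iff]
    refine ⟨fun s h0 h1 => Subtype.ext (funext fun x => ?_), fun s _ => ?_⟩
    · exact Submodule.disjoint_def.1 (CliffordAlgebra.evenOdd_isCompl _).disjoint _
        (h0 x trivial) (h1 x trivial)
    · have hev : ∀ x : U, (2⁻¹ : ℂ) • (s.1 x + AllSections.involute E U s.1 x) ∈
          CliffordAlgebra.evenOdd (0 : QuadraticForm ℂ (E x.1)) 0 ∧
          (2⁻¹ : ℂ) • (s.1 x - AllSections.involute E U s.1 x) ∈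
          CliffordAlgebra.evenOdd (0 : QuadraticForm ℂ (E x.1)) 1 := by
        intro x
        obtain ⟨a, ha, b, hb, hab⟩ := Submodule.mem_sup.1
          ((CliffordAlgebra.evenOdd_isCompl (0 : QuadraticForm ℂ (E x.1))).sup_eq_top ▸
            Submodule.mem_top : s.1 x ∈ _ ⊔ _)
        have hi : AllSections.involute E U s.1 x = a - b := by
          change CliffordAlgebra.involute (s.1 x) = _
          rw [← hab, map_add, CliffordAlgebra.involute_eq_of_mem_even ha,
            CliffordAlgebra.involute_eq_of_mem_odd hb, sub_eq_add_neg]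
        rw [hi, ← hab]
        have e1 : (2⁻¹ : ℂ) • (a + b + (a - b)) = a := by module
        have e2 : (2⁻¹ : ℂ) • (a + b - (a - b)) = b := by module
        rw [e1, e2]
        exact ⟨ha, hb⟩
      refine Submodule.mem_sup.2 ⟨⟨(2⁻¹ : ℂ) • (s.1 + AllSections.involute E U s.1),
        Subalgebra.smul_mem _ (add_mem s.2 (involute_mem_exteriorSections B F E s.2)) _⟩,
        fun x _ => (hev x).1, ⟨(2⁻¹ : ℂ) • (s.1 - AllSections.involute E U s.1),
        Subalgebra.smul_mem _ (sub_mem s.2 (involute_mem_exteriorSections B F E s.2)) _⟩,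
        fun x _ => (hev x).2, Subtype.ext ?_⟩
      change (2⁻¹ : ℂ) • (s.1 + AllSections.involute E U s.1) +
        (2⁻¹ : ℂ) • (s.1 - AllSections.involute E U s.1) = s.1
      module
  one_mem U x _ := Submodule.one_le.1 (CliffordAlgebra.one_le_evenOdd_zero _)
  mul_mem U i j a b ha hb x _ := CliffordAlgebra.evenOdd_mul_le _ i j
    (Submodule.mul_mem_mul (ha x trivial) (hb x trivial))
  supercomm U i j a b ha hb := by
    refine Subtype.ext (funext fun x => ?_)
    have h := CliffordAlgebra.map_mul_map_of_isOrtho_of_mem_evenOdd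
      (QuadraticMap.Isometry.id (0 : QuadraticForm ℂ (E x.1)))
      (QuadraticMap.Isometry.id (0 : QuadraticForm ℂ (E x.1)))
      (fun _ _ => by simp [QuadraticMap.IsOrtho]) _ _ (ha x trivial) (hb x trivial)
    rw [CliffordAlgebra.map_id] at h
    exact h.trans (neg_one_pow_parity_smul i j _)
  map_mem U V h i a ha x _ := ha ⟨x.1, h x.2⟩ trivial

end Exterior

/-- A complex supermanifold on the complex manifold `M` (with model space `B`), in the sense of
Berezin, Kostant and Leites: a sheaf of supercommutative algebras on `M` which is locally isomorphic
to `𝒪_M ⊗ Λ(ℂ^q)`, the sheaf of sections of the exterior algebra of a trivial bundle of rank the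
odd dimension `q`. -/
structure ComplexSupermanifold (B : Type*) [NormedAddCommGroup B] [NormedSpace ℂ B]
    (M : Type u) [TopologicalSpace M] [ChartedSpace B M] extends
    SuperalgebraSheaf.{u, v} (TopCat.of M) where
  /-- the odd dimension -/
  oddDim : ℕ
  locally_split : ∀ x : M, ∃ U : Opens M, x ∈ U ∧ Nonempty (LocalIso toSuperalgebraSheaf
    (exteriorSheaf B (EuclideanSpace ℂ (Fin oddDim))
      (Bundle.Trivial M (EuclideanSpace ℂ (Fin oddDim)))) U)

/-- A supermanifold of odd dimension `2s` or `2s + 1` is nildominated if it is `2s`-nildominated. -/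
def ComplexSupermanifold.IsNildominated {B : Type*} [NormedAddCommGroup B] [NormedSpace ℂ B]
    {M : Type u} [TopologicalSpace M] [ChartedSpace B M]
    (S : ComplexSupermanifold.{u, v} B M) : Prop :=
  ∃ s : ℕ, (S.oddDim = 2 * s ∨ S.oddDim = 2 * s + 1) ∧ S.IsNildominatedInDegree (2 * s)

/-! ## The logarithm of a unipotent endomorphism of an algebra is a derivation -/

/-! If `γ` is compatible, then `γᵢⱼ` and `αᵢⱼ` both conjugate `Xⱼ` into `Xᵢ`, so the unipotent
automorphism `u = γᵢⱼ αᵢⱼ⁻¹` commutes with every `Xᵢ`, and hence so does `log u`. Now `log u` is an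
even derivation of degree at least two: the logarithm of an algebra automorphism satisfies the
Leibniz rule, and an even map that raises the degree raises it by at least two, because the degree
modulo 2 is the parity. Pulled back along `φᵢ`, it commutes with all global derivations `X`, so
nildomination puts it in degree `2s`. Inverting the logarithm degree by degree shows that `u - 1`,
hence also `γᵢⱼ - αᵢⱼ = (u - 1) αᵢⱼ`, has degree at least `2s`, and a telescoping sum carries this
over to `log γᵢⱼ - log αᵢⱼ`. This is (1); see `IsCompatible.value_sub_value_mem`.

For (2), let `N` be the rank of `E`. It is at most the odd dimension, so `N - 1 ≤ 2s`, and `Z = γ -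
α` has degree at least `N - 1`. Since `𝒪⁽ᴺ⁺¹⁾ = 0`, products of `Z` with maps of degree two vanish.
Unipotent factors therefore act on `Z` as the identity, `Z = u - 1 = log u` is a derivation, and the
multiplicative cocycle condition for `γ` and `α` becomes the additive one for `Z`. If `Z` bounds a
cochain `(Zₖ)` on a refinement and `N ≥ 2`, the automorphisms `1 + Zₖ` make `γ` and `α`
cohomologous. If `N < 2`, there are no nontrivial unipotent automorphisms.

The facts needed about `ΛE` are that nilpotent sections lie locally in the ideal generated by odd
sections (`exteriorSheaf_isOddGenerated`) and that `𝒪⁽ᴺ⁺¹⁾ = 0` (`exteriorSheaf_filtration_eq_bot`).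
-/

section LogDerivation

open Polynomial

/-- The binomial coefficient `X choose k` as a polynomial. -/
noncomputable def binomialPolynomial (k : ℕ) : ℂ[X] :=
  C ((k.factorial : ℂ)⁻¹) * descPochhammer ℂ k

theorem binomialPolynomial_eval_natCast (k n : ℕ) :
    (binomialPolynomial k).eval (n : ℂ) = (n.choose k : ℂ) := by
  rw [binomialPolynomial, eval_mul, eval_C, descPochhammer_eval_eq_descFactorial,
    Nat.descFactorial_eq_factorial_mul_choose, Nat.cast_mul,
    inv_mul_cancel_left₀ (Nat.cast_ne_zero.2 k.factorial_ne_zero)]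

theorem binomialPolynomial_zero : binomialPolynomial 0 = 1 := by
  simp [binomialPolynomial]

theorem binomialPolynomial_succ_eval_zero (k : ℕ) : (binomialPolynomial (k + 1)).eval 0 = 0 := by
  simp [binomialPolynomial]

theorem descPochhammer_eval_neg_one (k : ℕ) :
    (descPochhammer ℂ k).eval (-1) = (-1) ^ k * (k.factorial : ℂ) := by
  induction k with
  | zero => simp
  | succ k ih =>
    rw [descPochhammer_succ_eval, ih, Nat.factorial_succ]
    push_cast
    ring

/-- These are the coefficients of the logarithm series: formally, `log g` is the derivative at `t =
0` of `g ^ t = ∑ (t choose k) (g - 1) ^ k`. -/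
theorem binomialPolynomial_succ_derivative_eval_zero (k : ℕ) :
    (derivative (binomialPolynomial (k + 1))).eval 0 = (-1) ^ k / (k + 1 : ℂ) := by
  have h : (k.factorial : ℂ) ≠ 0 := Nat.cast_ne_zero.2 k.factorial_ne_zero
  have h' : (k + 1 : ℂ) ≠ 0 := Nat.cast_add_one_ne_zero k
  rw [binomialPolynomial, derivative_C_mul, descPochhammer_succ_left, derivative_mul]
  simp only [derivative_X, one_mul, eval_mul, eval_C, eval_add, eval_comp, eval_sub, eval_X,
    eval_one, zero_sub, zero_mul, add_zero, descPochhammer_eval_neg_one, Nat.factorial_succ]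
  push_cast
  field_simp

theorem Polynomial.eq_zero_of_eval_natCast (p : ℂ[X]) (h : ∀ n : ℕ, p.eval (n : ℂ) = 0) : p = 0 :=
  p.eq_zero_of_infinite_isRoot <|
    (Set.infinite_range_of_injective (Nat.cast_injective (R := ℂ))).mono
      (by rintro _ ⟨n, rfl⟩; exact h n)

variable {A : Type*} [Ring A] [Algebra ℂ A]

theorem Module.End.pow_eq_sum_choose_smul {W : Type*} [AddCommGroup W] [Module ℂ W]
    (g : Module.End ℂ W) {K : ℕ} (hK : (g - 1) ^ K = 0) (n : ℕ) :
    g ^ n = ∑ k ∈ Finset.range (K + 1), (n.choose k : ℂ) • (g - 1) ^ k := by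
  have h1 : g ^ n = ∑ k ∈ Finset.range (n + 1), (n.choose k : ℂ) • (g - 1) ^ k := by
    conv_lhs => rw [← sub_add_cancel g 1, (Commute.one_right (g - 1)).add_pow]
    refine Finset.sum_congr rfl fun k _ => ?_
    rw [one_pow, mul_one, Nat.cast_smul_eq_nsmul, nsmul_eq_mul, Nat.cast_comm]
  rw [h1]
  rcases le_total n K with h | h
  · refine Finset.sum_subset (Finset.range_mono (by omega)) fun k _ hk => ?_
    rw [Nat.choose_eq_zero_of_lt (by simpa using hk), Nat.cast_zero, zero_smul]
  · refine (Finset.sum_subset (Finset.range_mono (by omega)) fun k _ hk => ?_).symm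
    rw [pow_eq_zero_of_le (by simp at hk; omega) hK, smul_zero]

/-- Each power `g ^ n` is multiplicative, and by the binomial expansion both sides of `g ^ n (a b) =
g ^ n a * g ^ n b` are polynomial in `n`. The identity therefore holds for a formal exponent, and
its derivative at exponent `0` is the Leibniz rule for the logarithm. -/
theorem Module.End.log_apply_mul (g : Module.End ℂ A) (hg : ∀ a b, g (a * b) = g a * g b)
    {K : ℕ} (hK : (g - 1) ^ K = 0) {D : Module.End ℂ A}
    (hD : D = ∑ n ∈ Finset.range K, ((-1 : ℂ) ^ n / (n + 1 : ℂ)) • (g - 1) ^ (n + 1)) (a b : A) :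
    D (a * b) = D a * b + a * D b := by
  have hpow : ∀ (n : ℕ) (a b : A), (g ^ n) (a * b) = (g ^ n) a * (g ^ n) b := by
    intro n
    induction n with
    | zero => simp
    | succ n ih => intro a b; simp only [pow_succ, Module.End.mul_apply, hg, ih]
  -- Linear functionals separate points and turn the identity in `A` into one between scalar
  -- polynomials.
  rw [← sub_eq_zero, ← Module.forall_dual_apply_eq_zero_iff ℂ]
  intro l
  set d := g - 1 with hd
  let p : ℂ[X] := ∑ k ∈ Finset.range (K + 1), C (l ((d ^ k) (a * b))) * binomialPolynomial k -
    ∑ k ∈ Finset.range (K + 1), ∑ m ∈ Finset.range (K + 1),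
      C (l ((d ^ k) a * (d ^ m) b)) * (binomialPolynomial k * binomialPolynomial m)
  have hp : p = 0 := by
    refine p.eq_zero_of_eval_natCast fun n => ?_
    have h := hpow n a b
    rw [g.pow_eq_sum_choose_smul hK n, ← sub_eq_zero] at h
    have h' := congrArg l h
    simp only [LinearMap.sum_apply, LinearMap.smul_apply, Finset.sum_mul_sum, smul_mul_smul_comm,
      map_sub, map_sum, map_smul, map_zero, smul_eq_mul] at h'
    simp only [p, eval_sub, eval_finsetSum, eval_mul, eval_C, binomialPolynomial_eval_natCast]
    rw [← h']
    simp only [mul_comm, hd]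
  -- At `0` only the constant polynomial of index `0` is nonzero, so the product rule leaves just
  -- the terms with `k = 0` or `m = 0`.
  have hp' := congrArg (fun q : ℂ[X] => (derivative q).eval 0) hp
  simp only [p, derivative_sub, derivative_add, derivative_sum, derivative_mul, derivative_C, zero_mul, zero_add,
    eval_sub, eval_finsetSum, eval_mul, eval_C, eval_add, derivative_zero, eval_zero,
    Finset.sum_range_succ' _ K, binomialPolynomial_zero, binomialPolynomial_succ_eval_zero,
    binomialPolynomial_succ_derivative_eval_zero, mul_zero, mul_one,
    add_zero, one_mul, Finset.sum_const_zero, pow_zero, Module.End.one_apply] at hp'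
  rw [← hp']
  simp only [hD, LinearMap.sum_apply, LinearMap.smul_apply, Finset.sum_mul, Finset.mul_sum, map_sub,
    map_add, map_sum, map_smul, smul_mul_assoc, mul_smul_comm, smul_eq_mul, mul_comm]

end LogDerivation

/-! ## Filtered and even endomorphisms of a sheaf of superalgebras -/

theorem Submodule.mem_mul_of_le {A : Type*} [Ring A] [Algebra ℂ A] {P P' Q Q' : Submodule ℂ A}
    (h : P ≤ P') (h' : Q ≤ Q') {a : A} (ha : a ∈ P * Q) : a ∈ P' * Q' :=
  (mul_le_mul' h h' : P * Q ≤ P' * Q') ha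

theorem Submodule.top_mul_top {A : Type*} [Ring A] [Algebra ℂ A] :
    (⊤ : Submodule ℂ A) * ⊤ = ⊤ :=
  eq_top_iff.2 fun f _ => by
    simpa using Submodule.mul_mem_mul (Submodule.mem_top (x := f)) (Submodule.mem_top (x := 1))

namespace SuperalgebraSheaf

section Filtered

variable {X : TopCat.{u}} {O : SuperalgebraSheaf.{u, v} X} {U : Opens X}

theorem filtration_zero (V : Opens X) : O.filtration 0 V = ⊤ := by
  refine eq_top_iff.2 fun f _ x hx => ⟨V, le_rfl, hx, ?_⟩
  rw [pow_zero, mul_one]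
  trivial

theorem mem_filtration_of_local {t : ℕ} {f : O.Sec U}
    (h : ∀ x ∈ U, ∃ (V : Opens X) (h : V ≤ U), x ∈ V ∧ O.res h f ∈ O.filtration t V) :
    f ∈ O.filtration t U := by
  intro x hx
  obtain ⟨V, hV, hxV, hf⟩ := h x hx
  obtain ⟨W, hW, hxW, hf'⟩ := hf x hxV
  exact ⟨W, hW.trans hV, hxW, by simpa using hf'⟩

variable (O U) in
/-- The endomorphisms of `𝒪|_U` which raise the degree in the filtration by at least `k`. -/
def filteredEnd (k : ℤ) : Submodule ℂ (O.End U) where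
  carrier := {φ | IsFiltered k φ}
  zero_mem' _ _ _ _ := Submodule.zero_mem _
  add_mem' h h' V t f hf := Submodule.add_mem _ (h V t f hf) (h' V t f hf)
  smul_mem' _ _ h V t f hf := Submodule.smul_mem _ _ (h V t f hf)

variable (O U) in
/-- The even endomorphisms of `𝒪|_U`. -/
def evenEnd : Subalgebra ℂ (O.End U) where
  carrier := {φ | IsEven φ}
  mul_mem' h h' V i f hf := h V i _ (h' V i f hf)
  add_mem' h h' V i f hf := Submodule.add_mem _ (h V i f hf) (h' V i f hf)
  algebraMap_mem' c _ _ _ hf := Submodule.smul_mem _ c hf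

theorem filteredEnd_antitone {k l : ℤ} (h : k ≤ l) : O.filteredEnd U l ≤ O.filteredEnd U k :=
  fun _ hφ V t f hf => O.filtration_antitone (by omega) _ (hφ V t f hf)

theorem mul_mem_filteredEnd {k l : ℤ} {φ ψ : O.End U} (hφ : φ ∈ O.filteredEnd U k)
    (hψ : ψ ∈ O.filteredEnd U l) : φ * ψ ∈ O.filteredEnd U (k + l) :=
  -- For negative degrees `toNat` truncates after each factor; this can only increase the resulting
  -- degree.
  fun V t f hf => O.filtration_antitone (by omega) _ (hφ V _ _ (hψ V t f hf))

theorem one_mem_filteredEnd : (1 : O.End U) ∈ O.filteredEnd U 0 := fun V t f hf => by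
  simpa using hf

theorem pow_mem_filteredEnd {d : O.End U} {k : ℤ} (hd : d ∈ O.filteredEnd U k) (n : ℕ) :
    d ^ n ∈ O.filteredEnd U (n * k) := by
  induction n with
  | zero => simpa using one_mem_filteredEnd
  | succ n ih =>
    rw [pow_succ, Nat.cast_succ, add_mul, one_mul]
    exact mul_mem_filteredEnd ih hd

theorem eq_zero_of_mem_filteredEnd {m : ℕ} (hm : ∀ V, O.filtration m V = ⊥) {k : ℤ} (hk : m ≤ k)
    {φ : O.End U} (hφ : φ ∈ O.filteredEnd U k) : φ = 0 := by
  refine Subtype.ext (funext fun V => LinearMap.ext fun f => ?_)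
  have h := O.filtration_antitone (s := m) (by omega) _
    (hφ V 0 f (by rw [filtration_zero]; trivial))
  rwa [hm, Submodule.mem_bot] at h

theorem pow_eq_zero_of_mem_filteredEnd {m : ℕ} (hm : ∀ V, O.filtration m V = ⊥) {d : O.End U}
    (hd : d ∈ O.filteredEnd U 1) : d ^ m = 0 :=
  eq_zero_of_mem_filteredEnd hm (by simp) (pow_mem_filteredEnd hd m)

theorem mem_filteredEnd_zero_of_mem_unipotent {g : (O.End U)ˣ} (hg : g ∈ O.unipotent U) :
    g.1 ∈ O.filteredEnd U 0 := fun V t f hf => by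
  simpa using O.filtration_map_of_mul g.1 hg.1 hg.2.1 V t f hf

theorem mem_evenEnd_of_mem_unipotent {g : (O.End U)ˣ} (hg : g ∈ O.unipotent U) :
    g.1 ∈ O.evenEnd U := hg.2.2.1

theorem sub_one_mem_evenEnd {g : (O.End U)ˣ} (hg : g ∈ O.unipotent U) :
    g.1 - 1 ∈ O.evenEnd U := sub_mem (mem_evenEnd_of_mem_unipotent hg) (Subalgebra.one_mem _)

end Filtered

/-! ### The logarithm -/

section Log

variable {X : TopCat.{u}} {O : SuperalgebraSheaf.{u, v} X} {U : Opens X}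

/-- Allows logarithms of different endomorphisms to be compared over one common range of summation.
-/
theorem log_eq_sum {g : O.End U} {K : ℕ} (hK : (g - 1) ^ K = 0) :
    O.log g = ∑ n ∈ Finset.range K, ((-1 : ℂ) ^ n / (n + 1 : ℂ)) • (g - 1) ^ (n + 1) := by
  refine Finset.sum_subset (Finset.range_mono (Nat.sInf_le hK))
    fun n _ hn => ?_
  have h : nilpotencyClass (g - 1) ≤ n + 1 := by simp at hn; omega
  rw [pow_eq_zero_of_le h (pow_nilpotencyClass ⟨K, hK⟩), smul_zero]

theorem commute_log {g X : O.End U} (h : Commute g X) : Commute (O.log g) X := by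
  refine Commute.sum_left _ _ _ fun n _ => Commute.smul_left ?_ _
  exact (h.sub_left (Commute.one_left X)).pow_left _

theorem log_mem_evenEnd {g : O.End U} (hg : g ∈ O.evenEnd U) : O.log g ∈ O.evenEnd U :=
  sum_mem fun _ _ => Subalgebra.smul_mem _ (pow_mem (sub_mem hg (Subalgebra.one_mem _)) _) _

theorem log_mem_filteredEnd_one {g : O.End U} (hg : g - 1 ∈ O.filteredEnd U 1) :
    O.log g ∈ O.filteredEnd U 1 :=
  sum_mem fun n _ => Submodule.smul_mem _ _
    (filteredEnd_antitone (by push_cast; omega) (pow_mem_filteredEnd hg (n + 1)))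

theorem log_apply_mul {g : O.End U} {K : ℕ} (hK : (g - 1) ^ K = 0)
    (hg : ∀ (V : {V : Opens X // V ≤ U}) (a b : O.Sec V), g.1 V (a * b) = g.1 V a * g.1 V b)
    (V : {V : Opens X // V ≤ U}) (a b : O.Sec V) :
    (O.log g).1 V (a * b) = (O.log g).1 V a * b + a * (O.log g).1 V b := by
  let ev : O.End U →ₐ[ℂ] Module.End ℂ (O.Sec V) := (Pi.evalAlgHom ℂ _ V).comp (O.End U).val
  refine Module.End.log_apply_mul (ev g) (hg V) (K := K) ?_ (D := ev (O.log g)) ?_ a b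
  · rw [← map_one ev, ← map_sub, ← map_pow, hK, map_zero]
  · rw [log_eq_sum hK]
    simp only [map_sum, map_smul, map_pow, map_sub, map_one]

/-- The difference of powers telescopes into products that each contain one factor `g - g'`; the
remaining factors do not lower the degree. -/
theorem log_sub_log_mem_filteredEnd {g g' : O.End U} {K : ℕ} (hK : (g - 1) ^ K = 0)
    (hK' : (g' - 1) ^ K = 0) (hg : g - 1 ∈ O.filteredEnd U 1) (hg' : g' - 1 ∈ O.filteredEnd U 1)
    {k : ℤ} (h : g - g' ∈ O.filteredEnd U k) : O.log g - O.log g' ∈ O.filteredEnd U k := by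
  have hpow : ∀ n : ℕ, (g - 1) ^ n - (g' - 1) ^ n ∈ O.filteredEnd U k := by
    intro n
    induction n with
    | zero => simp
    | succ n ih =>
      have e : (g - 1) ^ (n + 1) - (g' - 1) ^ (n + 1) =
          (g - 1) ^ n * (g - g') + ((g - 1) ^ n - (g' - 1) ^ n) * (g' - 1) := by
        rw [pow_succ, pow_succ]
        noncomm_ring
      rw [e]
      refine add_mem ?_ ?_
      · exact filteredEnd_antitone (by simp) (mul_mem_filteredEnd (pow_mem_filteredEnd hg n) h)
      · exact filteredEnd_antitone (by simp) (mul_mem_filteredEnd ih hg')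
  rw [log_eq_sum hK, log_eq_sum hK', ← Finset.sum_sub_distrib]
  exact sum_mem fun n _ => by rw [← smul_sub]; exact Submodule.smul_mem _ _ (hpow _)

/-- Bootstrapping replaces the exponential: with `d = g - 1`, the relation `d = log g - d² v` shows
that the known degree of `d` improves by one at each step until it reaches `k`. -/
theorem sub_one_mem_filteredEnd_of_log {g : O.End U} {K : ℕ} (hK : (g - 1) ^ K = 0)
    (hg : g - 1 ∈ O.filteredEnd U 1) {k : ℤ} (h : O.log g ∈ O.filteredEnd U k) :
    g - 1 ∈ O.filteredEnd U k := by
  set d := g - 1 with hd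
  obtain ⟨v, hv, e⟩ : ∃ v ∈ O.filteredEnd U 0, O.log g = d + d * (d * v) := by
    -- `v` is the logarithm series with its first term removed and `d²` divided out of the rest.
    refine ⟨∑ n ∈ Finset.range K, ((-1 : ℂ) ^ (n + 1) / ((n + 1 : ℕ) + 1 : ℂ)) • d ^ n,
      sum_mem fun n _ => Submodule.smul_mem _ _
        (filteredEnd_antitone (by simp) (pow_mem_filteredEnd hg n)), ?_⟩
    rw [log_eq_sum (K := K + 1) (pow_eq_zero_of_le (Nat.le_succ K) hK), Finset.sum_range_succ',
      add_comm, Finset.mul_sum, Finset.mul_sum]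
    congr 1
    · simp [hd]
    · refine Finset.sum_congr rfl fun n _ => ?_
      rw [mul_smul_comm, mul_smul_comm, ← pow_succ', ← pow_succ']
  have key : ∀ j : ℕ, d ∈ O.filteredEnd U (min k (j + 1)) := by
    intro j
    induction j with
    | zero => exact filteredEnd_antitone (by simp) hg
    | succ j ih =>
      have e' : d = O.log g - d * (d * v) := by rw [e]; abel
      rw [e']
      refine sub_mem (filteredEnd_antitone (min_le_left _ _) h) ?_
      rw [← mul_assoc]
      exact filteredEnd_antitone (by push_cast; omega)
        (mul_mem_filteredEnd (mul_mem_filteredEnd ih hg) hv)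
  exact filteredEnd_antitone (le_min le_rfl (k.self_le_toNat.trans (Int.le_add_one le_rfl))) (key k.toNat)

end Log

/-! ### Sheaves whose nilpotent sections are locally generated by odd sections -/

section OddGenerated

variable {X : TopCat.{u}} (O : SuperalgebraSheaf.{u, v} X)

/-- Every nilpotent section lies locally in the ideal generated by the odd sections. -/
def IsOddGenerated : Prop :=
  ∀ (U : Opens X) (f : O.Sec U), IsNilpotent f → ∀ x ∈ U, ∃ (V : Opens X) (h : V ≤ U), x ∈ V ∧
    O.res h f ∈ (⊤ : Submodule ℂ (O.Sec V)) * O.parity V 1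

theorem isNilpotent_of_odd {U : Opens X} {f : O.Sec U} (hf : f ∈ O.parity U 1) :
    IsNilpotent f := by
  refine ⟨2, ?_⟩
  have h := O.supercomm U 1 1 f f hf hf
  rw [ZMod.val_one, mul_one, pow_one, neg_one_smul, ← sub_eq_zero, sub_neg_eq_add,
    ← two_smul ℂ] at h
  rw [sq]
  exact (smul_eq_zero.1 h).resolve_left two_ne_zero

theorem odd_le_nil (U : Opens X) : O.parity U 1 ≤ O.nil U :=
  fun _ hf => Submodule.subset_span (O.isNilpotent_of_odd hf)

theorem parity_mul_le (U : Opens X) (i j : ZMod 2) :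
    O.parity U i * O.parity U j ≤ O.parity U (i + j) :=
  Submodule.mul_le.2 fun a ha b hb => O.mul_mem U i j a b ha hb

theorem parity_commute (U : Opens X) (i j : ZMod 2) : Commute (O.parity U i) (O.parity U j) := by
  have h : ∀ i j : ZMod 2, O.parity U i * O.parity U j ≤ O.parity U j * O.parity U i :=
    fun i j => Submodule.mul_le.2 fun a ha b hb => by
      rw [O.supercomm U i j a b ha hb]
      exact Submodule.smul_mem _ _ (Submodule.mul_mem_mul hb ha)
  exact le_antisymm (h i j) (h j i)

theorem parity_sup (U : Opens X) : O.parity U 0 ⊔ O.parity U 1 = ⊤ := (O.isCompl U).sup_eq_top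

/-- Hence the left ideal generated by the odd sections is two-sided, and its powers are `⊤ * parity
1 ^ t`. -/
theorem top_commute_odd (U : Opens X) :
    Commute (⊤ : Submodule ℂ (O.Sec U)) (O.parity U 1) := by
  rw [← O.parity_sup U]
  exact (O.parity_commute U 0 1).add_left (O.parity_commute U 1 1)

theorem odd_pow_le_top_mul (U : Opens X) (t : ℕ) : O.parity U 1 ^ t ≤ ⊤ * O.parity U 1 ^ t :=
  fun f hf => by simpa using Submodule.mul_mem_mul (Submodule.mem_top (R := ℂ) (x := 1)) hf

theorem odd_pow_le (U : Opens X) (t : ℕ) : O.parity U 1 ^ t ≤ O.parity U (t : ZMod 2) := by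
  induction t with
  | zero => simpa [Submodule.one_le] using O.one_mem U
  | succ t ih =>
    rw [pow_succ, Nat.cast_succ]
    exact (mul_le_mul' ih le_rfl).trans (O.parity_mul_le U _ _)

theorem res_mem_top_mul_odd_pow {U V : Opens X} (h : V ≤ U) (t : ℕ) {f : O.Sec U}
    (hf : f ∈ (⊤ : Submodule ℂ (O.Sec U)) * O.parity U 1 ^ t) :
    O.res h f ∈ (⊤ : Submodule ℂ (O.Sec V)) * O.parity V 1 ^ t := by
  have h' : O.res h f ∈
      ((⊤ : Submodule ℂ (O.Sec U)) * O.parity U 1 ^ t).map (O.res h).toLinearMap := ⟨f, hf, rfl⟩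
  rw [Submodule.map_mul, Submodule.map_pow] at h'
  refine Submodule.mem_mul_of_le le_top (pow_le_pow_left' ?_ t) h'
  rintro _ ⟨a, ha, rfl⟩
  exact O.map_mem U V h 1 a ha

/-- The sections which locally lie in the `t`-th power of the ideal generated by the odd
sections. -/
def oddPower (t : ℕ) (U : Opens X) : Submodule ℂ (O.Sec U) where
  carrier := {f | ∀ x ∈ U, ∃ (V : Opens X) (h : V ≤ U), x ∈ V ∧
    O.res h f ∈ (⊤ : Submodule ℂ (O.Sec V)) * O.parity V 1 ^ t}
  zero_mem' x hx := ⟨U, le_rfl, hx, by simp⟩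
  add_mem' := by
    intro f g hf hg x hx
    obtain ⟨V, hV, hxV, hfV⟩ := hf x hx
    obtain ⟨W, hW, hxW, hgW⟩ := hg x hx
    refine ⟨V ⊓ W, inf_le_left.trans hV, ⟨hxV, hxW⟩, ?_⟩
    rw [map_add]
    refine Submodule.add_mem _ ?_ ?_
    · simpa using O.res_mem_top_mul_odd_pow (inf_le_left : V ⊓ W ≤ V) t hfV
    · simpa using O.res_mem_top_mul_odd_pow (inf_le_right : V ⊓ W ≤ W) t hgW
  smul_mem' := by
    intro c f hf x hx
    obtain ⟨V, hV, hxV, hfV⟩ := hf x hx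
    exact ⟨V, hV, hxV, by rw [map_smul]; exact Submodule.smul_mem _ _ hfV⟩

theorem top_mul_odd_pow_mul (U : Opens X) (s t : ℕ) :
    ((⊤ : Submodule ℂ (O.Sec U)) * O.parity U 1 ^ s) * (⊤ * O.parity U 1 ^ t) =
      ⊤ * O.parity U 1 ^ (s + t) := by
  rw [mul_assoc, ← mul_assoc (O.parity U 1 ^ s), ← ((O.top_commute_odd U).pow_right s).eq,
    mul_assoc, ← mul_assoc ⊤ ⊤, Submodule.top_mul_top, pow_add]

theorem oddPower_mul_le (s t : ℕ) (U : Opens X) :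
    O.oddPower s U * O.oddPower t U ≤ O.oddPower (s + t) U := by
  refine Submodule.mul_le.2 fun f hf g hg x hx => ?_
  obtain ⟨V, hV, hxV, hfV⟩ := hf x hx
  obtain ⟨W, hW, hxW, hgW⟩ := hg x hx
  refine ⟨V ⊓ W, inf_le_left.trans hV, ⟨hxV, hxW⟩, ?_⟩
  rw [map_mul, ← top_mul_odd_pow_mul]
  refine Submodule.mul_mem_mul ?_ ?_
  · simpa using O.res_mem_top_mul_odd_pow (inf_le_left : V ⊓ W ≤ V) s hfV
  · simpa using O.res_mem_top_mul_odd_pow (inf_le_right : V ⊓ W ≤ W) t hgW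

variable {O}

/-- Nilpotent sections need not be homogeneous. Locally replacing them by combinations of odd
sections ties the degree in the filtration to the parity. -/
theorem IsOddGenerated.filtration_le_oddPower (hO : O.IsOddGenerated) (t : ℕ) (U : Opens X) :
    O.filtration t U ≤ O.oddPower t U := by
  have hpow : ∀ (t : ℕ) (V : Opens X), (⊤ : Submodule ℂ (O.Sec V)) * O.nil V ^ t ≤
      O.oddPower t V := by
    intro t V
    induction t with
    | zero => exact fun f _ x hx => ⟨V, le_rfl, hx, by simp⟩
    | succ t ih =>
      rw [pow_succ, ← mul_assoc]
      refine (mul_le_mul' ih ?_).trans (O.oddPower_mul_le t 1 V)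
      refine Submodule.span_le.2 fun f hf x hx => ?_
      simpa using hO V f hf x hx
  intro f hf x hx
  obtain ⟨V, hV, hxV, hfV⟩ := hf x hx
  obtain ⟨W, hW, hxW, hfW⟩ := hpow t V hfV x hxV
  exact ⟨W, hW.trans hV, hxW, by simpa using hfW⟩

theorem top_mul_odd_pow_le_filtration (t : ℕ) (U : Opens X) :
    (⊤ : Submodule ℂ (O.Sec U)) * O.parity U 1 ^ t ≤ O.filtration t U :=
  fun _ hf _ hx => ⟨U, le_rfl, hx, by
    rw [res_self]
    exact Submodule.mem_mul_of_le le_rfl (pow_le_pow_left' (O.odd_le_nil U) t) hf⟩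

/-- Splitting the coefficient by parity isolates a leading part of parity `t`; an odd coefficient
already gives one more odd factor. -/
theorem top_mul_odd_pow_eq (U : Opens X) (t : ℕ) :
    (⊤ : Submodule ℂ (O.Sec U)) * O.parity U 1 ^ t =
      O.parity U 0 * O.parity U 1 ^ t ⊔ O.parity U 1 ^ (t + 1) := by
  rw [← O.parity_sup U, Submodule.sup_mul, pow_succ']

theorem disjoint_parity (U : Opens X) (i : ZMod 2) :
    Disjoint (O.parity U i) (O.parity U (i + 1)) := by
  fin_cases i
  · exact (O.isCompl U).disjoint
  · exact (O.isCompl U).disjoint.symm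

/-- A section in `𝒪⁽ᵗ⁾` of the parity of `t + 1` lies in `𝒪⁽ᵗ⁺¹⁾`. -/
theorem IsOddGenerated.mem_filtration_succ (hO : O.IsOddGenerated) {t : ℕ} {U : Opens X}
    {f : O.Sec U} (hf : f ∈ O.filtration t U) (hf' : f ∈ O.parity U ((t + 1 : ℕ) : ZMod 2)) :
    f ∈ O.filtration (t + 1) U := by
  refine mem_filtration_of_local fun x hx => ?_
  obtain ⟨V, hV, hxV, hfV⟩ := hO.filtration_le_oddPower t U hf x hx
  refine ⟨V, hV, hxV, ?_⟩
  rw [top_mul_odd_pow_eq] at hfV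
  obtain ⟨a, ha, b, hb, hab⟩ := Submodule.mem_sup.1 hfV
  have hb' : b ∈ O.filtration (t + 1) V := top_mul_odd_pow_le_filtration (t + 1) V
    (O.odd_pow_le_top_mul V (t + 1) hb)
  -- The leading part `a` has parity `t`, but as `f - b` it also has parity `t + 1`, so it vanishes.
  have ha' : a ∈ O.parity V (t : ZMod 2) := by
    have := O.parity_mul_le V 0 t (Submodule.mem_mul_of_le le_rfl (O.odd_pow_le V t) ha)
    rwa [zero_add] at this
  have ha'' : a ∈ O.parity V ((t : ZMod 2) + 1) := by
    rw [eq_sub_of_add_eq hab]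
    have h1 := O.odd_pow_le V (t + 1) hb
    have h2 := O.map_mem U V hV _ f hf'
    rw [Nat.cast_succ] at h1 h2
    exact Submodule.sub_mem _ h2 h1
  rw [← hab, Submodule.disjoint_def.1 (disjoint_parity V t) a ha' ha'', zero_add]
  exact hb'

/-- An even endomorphism which raises the degree in the filtration raises it by at least two. -/
theorem IsOddGenerated.mem_filteredEnd_two (hO : O.IsOddGenerated) {U : Opens X} {φ : O.End U}
    (he : φ ∈ O.evenEnd U) (hφ : φ ∈ O.filteredEnd U 1) : φ ∈ O.filteredEnd U 2 := by
  intro V t f hf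
  refine mem_filtration_of_local fun x hx => ?_
  obtain ⟨W, hW, hxW, hfW⟩ := hO.filtration_le_oddPower t V hf x hx
  refine ⟨W, hW, hxW, ?_⟩
  rw [φ.2 V ⟨W, hW.trans V.2⟩ hW f]
  -- The part `b` with `t + 1` odd factors reaches degree `t + 2` by hypothesis. The leading part
  -- `a` has parity `t`, so its image lies in degree `t + 1` with the parity of `t + 2`, which
  -- forces degree `t + 2`.
  rw [top_mul_odd_pow_eq] at hfW
  obtain ⟨a, ha, b, hb, hab⟩ := Submodule.mem_sup.1 hfW
  rw [← hab, map_add]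
  refine Submodule.add_mem _ ?_ ?_
  · have ha1 : a ∈ O.filtration t W :=
      top_mul_odd_pow_le_filtration t W (Submodule.mem_mul_of_le le_top le_rfl ha)
    have ha2 : a ∈ O.parity W (t : ZMod 2) := by
      have := O.parity_mul_le W 0 t (Submodule.mem_mul_of_le le_rfl (O.odd_pow_le W t) ha)
      rwa [zero_add] at this
    have h2 : ((t + 1 + 1 : ℕ) : ZMod 2) = t := by
      push_cast
      rw [add_assoc]
      exact add_eq_left.2 (by decide)
    exact hO.mem_filtration_succ (t := t + 1) (hφ ⟨W, hW.trans V.2⟩ t a ha1)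
      (by rw [h2]; exact he ⟨W, hW.trans V.2⟩ _ a ha2)
  · have hb' : b ∈ O.filtration (t + 1) W := top_mul_odd_pow_le_filtration (t + 1) W
      (O.odd_pow_le_top_mul W (t + 1) hb)
    exact O.filtration_antitone (by push_cast; omega) W (hφ ⟨W, hW.trans V.2⟩ (t + 1) b hb')

theorem IsOddGenerated.sub_one_mem_filteredEnd_two (hO : O.IsOddGenerated) {U : Opens X}
    {g : (O.End U)ˣ} (hg : g ∈ O.unipotent U) : g.1 - 1 ∈ O.filteredEnd U 2 :=
  hO.mem_filteredEnd_two (sub_one_mem_evenEnd hg) hg.2.2.2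

theorem IsOddGenerated.log_mem_evenDer (hO : O.IsOddGenerated) {m : ℕ}
    (hm : ∀ V, O.filtration m V = ⊥) {U : Opens X} {g : (O.End U)ˣ} (hg : g ∈ O.unipotent U) :
    O.log g.1 ∈ O.evenDer 2 U :=
  ⟨log_apply_mul (pow_eq_zero_of_mem_filteredEnd hm hg.2.2.2) hg.2.1,
    log_mem_evenEnd (mem_evenEnd_of_mem_unipotent hg),
    hO.mem_filteredEnd_two (log_mem_evenEnd (mem_evenEnd_of_mem_unipotent hg))
      (log_mem_filteredEnd_one hg.2.2.2)⟩

end OddGenerated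

end SuperalgebraSheaf

/-! ## Transport along local isomorphisms -/

namespace LocalIso

variable {X : TopCat.{u}} {O : SuperalgebraSheaf.{u, v} X} {O' : SuperalgebraSheaf.{u, w} X}
  {U : Opens X} (φ : LocalIso O O' U)

/-- The inverse of a local isomorphism. -/
def symm : LocalIso O' O U where
  equiv V := (φ.equiv V).symm
  natural := φ.natural_symm
  parity := by
    -- The component of `φ⁻¹ f` of the wrong parity has an image lying in both parities; this image
    -- is zero, and `φ` is injective.
    have key : ∀ (V : {V : Opens X // V ≤ U}) (i j : ZMod 2), O.parity V i ⊔ O.parity V j = ⊤ →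
        Disjoint (O'.parity V i) (O'.parity V j) →
        ∀ f ∈ O'.parity V i, (φ.equiv V).symm f ∈ O.parity V i := by
      intro V i j hij hij' f hf
      obtain ⟨a, ha, b, hb, hab⟩ :=
        Submodule.mem_sup.1 (hij ▸ Submodule.mem_top : (φ.equiv V).symm f ∈ _ ⊔ _)
      have hf' : φ.equiv V a + φ.equiv V b = f := by rw [← map_add, hab, AlgEquiv.apply_symm_apply]
      have hb0 : φ.equiv V b = 0 := Submodule.disjoint_def.1 hij' _
        (by rw [← sub_eq_of_eq_add' hf'.symm]; exact Submodule.sub_mem _ hf (φ.parity V i a ha))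
        (φ.parity V j b hb)
      rw [← hab, (map_eq_zero_iff _ (φ.equiv V).injective).1 hb0, add_zero]
      exact ha
    intro V i
    fin_cases i
    · exact key V 0 1 (O.isCompl _).sup_eq_top (O'.isCompl _).disjoint
    · exact key V 1 0 (O.isCompl _).symm.sup_eq_top (O'.isCompl _).symm.disjoint

theorem equiv_mem_filtration (V : {V : Opens X // V ≤ U}) (t : ℕ) {f : O.Sec V}
    (hf : f ∈ O.filtration t V) : φ.equiv V f ∈ O'.filtration t V := by
  intro x hx
  obtain ⟨W, hW, hxW, hfW⟩ := hf x hx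
  refine ⟨W, hW, hxW, ?_⟩
  rw [φ.natural V ⟨W, hW.trans V.2⟩ hW f]
  set e := (φ.equiv ⟨W, hW.trans V.2⟩ : O.Sec W →ₐ[ℂ] O'.Sec W) with he
  have h : e (O.res hW f) ∈ ((⊤ : Submodule ℂ (O.Sec W)) * O.nil W ^ t).map e.toLinearMap :=
    ⟨_, hfW, rfl⟩
  rw [Submodule.map_mul, Submodule.map_pow] at h
  refine Submodule.mem_mul_of_le le_top (pow_le_pow_left' ?_ t) h
  rw [SuperalgebraSheaf.nil, Submodule.map_span_le]
  exact fun a ha => Submodule.subset_span (IsNilpotent.map (r := a) ha e)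

theorem conj_mem_evenDer {T : Opens X} (h : T ≤ U) {k : ℤ} {D : O.End T}
    (hD : D ∈ O.evenDer k T) : φ.conj h D ∈ O'.evenDer k T := by
  obtain ⟨h1, h2, h3⟩ := hD
  refine ⟨fun V f g => ?_, fun V i f hf => ?_, fun V t f hf => ?_⟩
  · change φ.equiv ⟨V.1, _⟩ (D.1 V ((φ.equiv ⟨V.1, _⟩).symm (f * g))) =
      φ.equiv ⟨V.1, _⟩ (D.1 V ((φ.equiv ⟨V.1, _⟩).symm f)) * g + f * φ.equiv ⟨V.1, _⟩ (D.1 V ((φ.equiv ⟨V.1, _⟩).symm g))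
    rw [map_mul, h1, map_add, map_mul, map_mul, AlgEquiv.apply_symm_apply,
      AlgEquiv.apply_symm_apply]
  · exact φ.parity ⟨V.1, V.2.trans h⟩ i _ (h2 V i _ (φ.symm.parity ⟨V.1, V.2.trans h⟩ i f hf))
  · exact φ.equiv_mem_filtration ⟨V.1, V.2.trans h⟩ _
      (h3 V t _ (φ.symm.equiv_mem_filtration ⟨V.1, V.2.trans h⟩ t hf))

theorem conj_conj_symm {T : Opens X} (h : T ≤ U) (D : O'.End T) :
    φ.conj h (φ.symm.conj h D) = D := by
  refine Subtype.ext (funext fun V => LinearMap.ext fun f => ?_)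
  change φ.equiv ⟨V.1, _⟩ ((φ.equiv ⟨V.1, _⟩).symm (D.1 V (φ.equiv ⟨V.1, V.2.trans h⟩ ((φ.equiv ⟨V.1, _⟩).symm f)))) = _
  rw [AlgEquiv.apply_symm_apply, AlgEquiv.apply_symm_apply]

theorem commute_symm_conj {T : Opens X} (h : T ≤ U) {D : O.End T} {D' : O'.End T}
    (hD : Commute (φ.conj h D) D') : Commute D (φ.symm.conj h D') := by
  refine Subtype.ext (funext fun V => LinearMap.ext fun f => ?_)
  have e := congrArg (fun ψ : O'.End T => ψ.1 V (φ.equiv ⟨V.1, V.2.trans h⟩ f)) hD.eq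
  change φ.equiv ⟨V.1, _⟩ (D.1 V ((φ.equiv ⟨V.1, _⟩).symm (D'.1 V (φ.equiv ⟨V.1, _⟩ f)))) =
    D'.1 V (φ.equiv ⟨V.1, _⟩ (D.1 V ((φ.equiv ⟨V.1, _⟩).symm (φ.equiv ⟨V.1, V.2.trans h⟩ f)))) at e
  rw [AlgEquiv.symm_apply_apply] at e
  change D.1 V ((φ.equiv ⟨V.1, V.2.trans h⟩).symm (D'.1 V (φ.equiv ⟨V.1, _⟩ f))) =
    (φ.equiv ⟨V.1, _⟩).symm (D'.1 V (φ.equiv ⟨V.1, _⟩ (D.1 V f)))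
  rw [← e, AlgEquiv.symm_apply_apply]

end LocalIso

/-! ## Unipotent automorphisms with quadratically small deviation -/

namespace SuperalgebraSheaf

section SmallDeviation

variable {X : TopCat.{u}} {O : SuperalgebraSheaf.{u, v} X} {U : Opens X} {N : ℕ}

/-- The degrees add up to `(N - 1) + 2 = N + 1`, where the filtration is zero. -/
theorem mul_eq_zero_of_mem_filteredEnd (hN : ∀ V, O.filtration (N + 1) V = ⊥) {Z Z' : O.End U}
    (hZ : Z ∈ O.filteredEnd U ((N : ℤ) - 1)) (hZ' : Z' ∈ O.filteredEnd U 2) :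
    Z * Z' = 0 ∧ Z' * Z = 0 :=
  ⟨eq_zero_of_mem_filteredEnd hN (by push_cast; omega) (mul_mem_filteredEnd hZ hZ'),
    eq_zero_of_mem_filteredEnd hN (by push_cast; omega) (mul_mem_filteredEnd hZ' hZ)⟩

theorem IsOddGenerated.mul_unipotent (hO : O.IsOddGenerated)
    (hN : ∀ V, O.filtration (N + 1) V = ⊥) {Z : O.End U}
    (hZ : Z ∈ O.filteredEnd U ((N : ℤ) - 1)) {g : (O.End U)ˣ} (hg : g ∈ O.unipotent U) :
    Z * g.1 = Z ∧ g.1 * Z = Z := by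
  obtain ⟨h1, h2⟩ := mul_eq_zero_of_mem_filteredEnd hN hZ (hO.sub_one_mem_filteredEnd_two hg)
  rw [mul_sub, mul_one, sub_eq_zero] at h1
  rw [sub_mul, one_mul, sub_eq_zero] at h2
  exact ⟨h1, h2⟩

/-- For `u = g a⁻¹` one has `u - 1 = (g - a) a⁻¹ = g - a`, and this squares to zero. So `g - a` is
all of `log u`, which is a derivation. -/
theorem IsOddGenerated.sub_mem_evenDer (hO : O.IsOddGenerated)
    (hN : ∀ V, O.filtration (N + 1) V = ⊥) {g a : (O.End U)ˣ} (hg : g ∈ O.unipotent U)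
    (ha : a ∈ O.unipotent U) (h : g.1 - a.1 ∈ O.filteredEnd U ((N : ℤ) - 1)) :
    g.1 - a.1 ∈ O.evenDer ((N : ℤ) - 1) U := by
  have hga : g * a⁻¹ ∈ O.unipotent U :=
    Subgroup.mul_mem _ hg (inv_mem ha)
  have e : (g * a⁻¹).1 - 1 = g.1 - a.1 := by
    have e' : (g * a⁻¹).1 - 1 = (g.1 - a.1) * (a⁻¹).1 := by
      rw [sub_mul, Units.mul_inv, Units.val_mul]
    rw [e', (hO.mul_unipotent hN h (inv_mem ha)).1]
  have h2 := hO.sub_one_mem_filteredEnd_two hga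
  have hsq : ((g * a⁻¹).1 - 1) ^ 2 = 0 := by
    rw [sq]
    exact (mul_eq_zero_of_mem_filteredEnd hN (e ▸ h) h2).1
  have hlog : O.log (g * a⁻¹).1 = (g * a⁻¹).1 - 1 := by
    rw [log_eq_sum hsq, Finset.sum_range_succ, Finset.sum_range_one, hsq]
    simp
  have hder := hO.log_mem_evenDer hN hga
  rw [hlog, e] at hder
  exact ⟨hder.1, hder.2.1, h⟩

theorem apply_one_of_mem_evenDer {k : ℤ} {Z : O.End U} (hZ : Z ∈ O.evenDer k U)
    (V : {V : Opens X // V ≤ U}) : Z.1 V 1 = 0 := by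
  have h := hZ.1 V 1 1
  rwa [mul_one, mul_one, one_mul, left_eq_add] at h

/-- The invertible endomorphism `1 + Z`, for `Z` of square zero. -/
def oneAddUnit (Z : O.End U) (hZ : Z * Z = 0) : (O.End U)ˣ where
  val := 1 + Z
  inv := 1 - Z
  val_inv := by rw [mul_sub, add_mul, add_mul, hZ]; simp
  inv_val := by rw [mul_add, sub_mul, sub_mul, hZ]; simp

theorem oneAddUnit_mem_unipotent {k : ℤ} (hk : 1 ≤ k) {Z : O.End U} (hZ : Z ∈ O.evenDer k U)
    (hsq : Z * Z = 0) : oneAddUnit Z hsq ∈ O.unipotent U := by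
  refine ⟨fun V => ?_, fun V f f' => ?_, ?_, ?_⟩
  · change 1 + Z.1 V 1 = 1
    rw [apply_one_of_mem_evenDer hZ, add_zero]
  -- Multiplicativity of `1 + Z` requires `Z f * Z f' = 0`, which follows from `0 = Z² (f f') = 2 (Z
  -- f * Z f')`.
  · have hz : ∀ f : O.Sec V, Z.1 V (Z.1 V f) = 0 := fun f =>
      congrArg (fun ψ : O.End U => ψ.1 V f) hsq
    have h := hz (f * f')
    rw [hZ.1, map_add, hZ.1, hZ.1, hz, hz, zero_mul, mul_zero, zero_add, add_zero,
      ← two_smul ℂ] at h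
    have h0 := (smul_eq_zero.1 h).resolve_left two_ne_zero
    change f * f' + Z.1 V (f * f') = (f + Z.1 V f) * (f' + Z.1 V f')
    rw [hZ.1, add_mul, mul_add, mul_add, h0]
    abel
  · exact (O.evenEnd U).add_mem (Subalgebra.one_mem _) hZ.2.1
  · have e : (oneAddUnit Z hsq).1 - 1 = Z := add_sub_cancel_left _ _
    rw [e]
    exact filteredEnd_antitone hk hZ.2.2

end SmallDeviation

end SuperalgebraSheaf

/-! ## Cochains compatible with the global unipotent automorphisms -/

namespace SplittingAtlas

open SuperalgebraSheaf

variable {X : TopCat.{u}} {O : SuperalgebraSheaf.{u, v} X} {O' : SuperalgebraSheaf.{u, w} X}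
  (A : SplittingAtlas O O')

theorem isCompatible_cocycle : A.IsCompatible A.cocycle.toOneCochain := by
  intro D _ i j
  refine Subtype.ext (funext fun V => LinearMap.ext fun f => ?_)
  change (A.chart i).equiv ⟨V.1, _⟩ (D.1 ⟨V.1, _⟩ (((A.chart i).equiv ⟨V.1, _⟩).symm f)) =
    (A.chart i).equiv ⟨V.1, _⟩ (((A.chart j).equiv ⟨V.1, _⟩).symm ((A.chart j).equiv ⟨V.1, _⟩
      (D.1 ⟨V.1, _⟩ (((A.chart j).equiv ⟨V.1, _⟩).symm ((A.chart j).equiv ⟨V.1, _⟩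
        (((A.chart i).equiv ⟨V.1, _⟩).symm f))))))
  rw [AlgEquiv.symm_apply_apply, AlgEquiv.symm_apply_apply]

/-! ### Compatible cochains agree with the cocycle of the atlas up to degree `k` -/

theorem value_mem (γ : PresheafOfGroups.OneCochain O'.unipotentPresheaf A.U) (i j : A.ι) :
    A.value γ i j ∈ O'.unipotent (A.U i ⊓ A.U j) :=
  (γ.ev i j (homOfLE inf_le_left) (homOfLE inf_le_right) : O'.unipotent (A.U i ⊓ A.U j)).2

/-- Nildomination is a condition on `𝒪`. The chart `φᵢ` carries it to `𝒪'`, matching each component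
`Xᵢ` with the restriction of the global derivation `X`. -/
theorem mem_evenDer_of_commute {k : ℕ} (hk : O.IsNildominatedInDegree k) (i : A.ι) {T : Opens X}
    (h : T ≤ A.U i) {Y : O'.End T} (hY : Y ∈ O'.evenDer 2 T)
    (hc : ∀ D ∈ O.evenDer 2 ⊤, Commute (O'.endRes h (A.component D i)) Y) :
    Y ∈ O'.evenDer k T := by
  rw [← (A.chart i).conj_conj_symm h Y]
  refine (A.chart i).conj_mem_evenDer h (hk T _ ((A.chart i).symm.conj_mem_evenDer h hY) ?_)
  intro D hD
  exact (commute_iff_lie_eq.1 ((A.chart i).commute_symm_conj h (hc D hD)))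

variable {A}

theorem IsCompatible.commute {γ : PresheafOfGroups.OneCochain O'.unipotentPresheaf A.U}
    (hγ : A.IsCompatible γ) {D : O.End ⊤} (hD : D ∈ O.evenDer 2 ⊤) (i j : A.ι) :
    Commute (A.value γ i j * (A.value A.cocycle.toOneCochain i j)⁻¹).1
      (O'.endRes inf_le_left (A.component D i)) := by
  have h1 := hγ D hD i j
  have h2 := A.isCompatible_cocycle D hD i j
  rw [Commute, SemiconjBy]
  conv_lhs => rw [h2]
  rw [h1, Units.val_mul]
  simp only [mul_assoc, Units.inv_mul_cancel_left]

/-- The heart of both statements: nildomination applies to `log (γᵢⱼ αᵢⱼ⁻¹)`, and the resulting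
degree passes to `γᵢⱼ αᵢⱼ⁻¹ - 1` and, after multiplication by `αᵢⱼ`, to `γᵢⱼ - αᵢⱼ`. -/
theorem IsCompatible.value_sub_value_mem (hO : O'.IsOddGenerated) {m : ℕ}
    (hm : ∀ V, O'.filtration m V = ⊥) {k : ℕ} (hk : O.IsNildominatedInDegree k)
    {γ : PresheafOfGroups.OneCochain O'.unipotentPresheaf A.U} (hγ : A.IsCompatible γ)
    (i j : A.ι) : (A.value γ i j).1 - (A.value A.cocycle.toOneCochain i j).1 ∈
      O'.filteredEnd (A.U i ⊓ A.U j) k := by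
  set g := A.value γ i j
  set a := A.value A.cocycle.toOneCochain i j
  have ha : a ∈ O'.unipotent (A.U i ⊓ A.U j) := A.value_mem _ i j
  have hga : g * a⁻¹ ∈ O'.unipotent (A.U i ⊓ A.U j) :=
    Subgroup.mul_mem _ (A.value_mem _ i j) (inv_mem ha)
  have hlog : O'.log (g * a⁻¹).1 ∈ O'.evenDer k (A.U i ⊓ A.U j) :=
    A.mem_evenDer_of_commute hk i inf_le_left (hO.log_mem_evenDer hm hga)
      fun D hD => (commute_log (hγ.commute hD i j)).symm
  have h := sub_one_mem_filteredEnd_of_log (pow_eq_zero_of_mem_filteredEnd hm hga.2.2.2)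
    hga.2.2.2 hlog.2.2
  have e : g.1 - a.1 = ((g * a⁻¹).1 - 1) * a.1 := by
    rw [sub_mul, Units.val_mul, Units.inv_mul_cancel_right, one_mul]
  rw [e]
  exact filteredEnd_antitone (by simp)
    (mul_mem_filteredEnd h (mem_filteredEnd_zero_of_mem_unipotent ha))

theorem isDeterminedUpTo (hO : O'.IsOddGenerated) {m : ℕ} (hm : ∀ V, O'.filtration m V = ⊥)
    {k : ℕ} (hk : O.IsNildominatedInDegree k) : A.IsDeterminedUpTo k := by
  have hlog : ∀ (γ : PresheafOfGroups.OneCochain O'.unipotentPresheaf A.U) (i j : A.ι),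
      O'.log (A.value γ i j).1 ∈ O'.evenDer 2 (A.U i ⊓ A.U j) := fun γ i j =>
    hO.log_mem_evenDer hm (A.value_mem γ i j)
  refine ⟨A.isCompatible_cocycle, hlog _, fun γ hγ i j => ?_⟩
  have h := Submodule.sub_mem _ (hlog γ i j) (hlog A.cocycle.toOneCochain i j)
  refine ⟨h.1, h.2.1, ?_⟩
  exact log_sub_log_mem_filteredEnd
    (pow_eq_zero_of_mem_filteredEnd hm (A.value_mem γ i j).2.2.2)
    (pow_eq_zero_of_mem_filteredEnd hm (A.value_mem _ i j).2.2.2)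
    (A.value_mem γ i j).2.2.2 (A.value_mem _ i j).2.2.2
    (hγ.value_sub_value_mem hO hm hk i j)

/-! ### From multiplicative cocycles to an additive cocycle of derivations, and back -/

/-- A value of a cochain with values in the unipotent automorphisms, as an endomorphism. -/
def endEv (γ : PresheafOfGroups.OneCochain O'.unipotentPresheaf A.U) (i j : A.ι) {T : Opens X}
    (a : T ⟶ A.U i) (b : T ⟶ A.U j) : O'.unipotent T := γ.ev i j a b

theorem endRes_value (γ : PresheafOfGroups.OneCochain O'.unipotentPresheaf A.U) (i j : A.ι)
    {T : Opens X} (a : T ⟶ A.U i) (b : T ⟶ A.U j) :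
    O'.endRes (le_inf a.le b.le) (A.value γ i j).1 = (endEv γ i j a b).1.1 :=
  congrArg (fun g : O'.unipotent T => g.1.1) (γ.ev_precomp i j (homOfLE (le_inf a.le b.le))
    (homOfLE inf_le_left) (homOfLE inf_le_right))

theorem endEv_trans (γ : PresheafOfGroups.OneCocycle O'.unipotentPresheaf A.U) (i j k : A.ι)
    {T : Opens X} (a : T ⟶ A.U i) (b : T ⟶ A.U j) (c : T ⟶ A.U k) :
    (endEv γ.toOneCochain i j a b).1.1 * (endEv γ.toOneCochain j k b c).1.1 =
      (endEv γ.toOneCochain i k a c).1.1 :=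
  congrArg (fun g : O'.unipotent T => g.1.1) (γ.ev_trans i j k a b c)

theorem endRes_endEv (γ : PresheafOfGroups.OneCochain O'.unipotentPresheaf A.U) (i j : A.ι)
    {T T' : Opens X} (φ : T ⟶ T') (a : T' ⟶ A.U i) (b : T' ⟶ A.U j) :
    O'.endRes φ.le (endEv γ i j a b).1.1 = (endEv γ i j (φ ≫ a) (φ ≫ b)).1.1 :=
  congrArg (fun g : O'.unipotent T => g.1.1) (γ.ev_precomp i j φ a b)

/-- The difference of two cocycles of unipotent automorphisms which differ by endomorphisms
annihilated by unipotent deviations, as an additive cocycle of derivations. -/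
noncomputable def differenceCocycle (hO : O'.IsOddGenerated) {N : ℕ}
    (hN : ∀ V, O'.filtration (N + 1) V = ⊥)
    (γ α : PresheafOfGroups.OneCocycle O'.unipotentPresheaf A.U)
    (h : ∀ (i j : A.ι) (T : Opens X) (a : T ⟶ A.U i) (b : T ⟶ A.U j),
      (endEv γ.toOneCochain i j a b).1.1 - (endEv α.toOneCochain i j a b).1.1 ∈
        O'.evenDer ((N : ℤ) - 1) T) :
    PresheafOfGroups.OneCocycle (O'.derPresheaf ((N : ℤ) - 1)) A.U where
  ev i j T a b := Multiplicative.ofAdd (⟨_, h i j T a b⟩ : O'.evenDer ((N : ℤ) - 1) T)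
  ev_precomp i j T T' φ a b := by
    refine Subtype.ext ?_
    change O'.endRes φ.le (_ - _) = _ - _
    rw [map_sub, endRes_endEv, endRes_endEv]
  ev_trans i j k T a b c := by
    refine Subtype.ext ?_
    change ((endEv γ.toOneCochain i j a b).1.1 - (endEv α.toOneCochain i j a b).1.1) +
      ((endEv γ.toOneCochain j k b c).1.1 - (endEv α.toOneCochain j k b c).1.1) =
      (endEv γ.toOneCochain i k a c).1.1 - (endEv α.toOneCochain i k a c).1.1
    -- In `γγ' - αα' = (γ - α)γ' + α(γ' - α')` the outer factors `γ'` and `α` act as the identity.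
    have h1 := (hO.mul_unipotent hN (h i j T a b).2.2 (endEv γ.toOneCochain j k b c).2).1
    have h2 := (hO.mul_unipotent hN (h j k T b c).2.2 (endEv α.toOneCochain i j a b).2).2
    rw [← endEv_trans γ i j k a b c, ← endEv_trans α i j k a b c, ← h1, ← h2]
    noncomm_ring

/-- Since `(1 + Zₖ) γ = γ + Zₖ` and `α (1 + Zₗ) = α + Zₗ`, the multiplicative coboundary relation is
the additive one. The bound `2 ≤ N` gives `Zₖ` positive degree, so that `1 + Zₖ` is unipotent. -/
theorem isCohomologous_refine_of_sub_eq (hO : O'.IsOddGenerated) {N : ℕ}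
    (hN : ∀ V, O'.filtration (N + 1) V = ⊥) (hN2 : 2 ≤ N)
    (γ α : PresheafOfGroups.OneCocycle O'.unipotentPresheaf A.U) {κ : Type u} (W : κ → Opens X)
    (r : κ → A.ι) (hr : ∀ k, W k ≤ A.U (r k)) (Z : ∀ k, O'.evenDer ((N : ℤ) - 1) (W k))
    (hZ : ∀ (k l : κ) (T : Opens X) (a : T ⟶ W k) (b : T ⟶ W l),
      O'.endRes a.le (Z k).1 +
        ((endEv γ.toOneCochain (r k) (r l) (a ≫ homOfLE (hr k)) (b ≫ homOfLE (hr l))).1.1 -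
        (endEv α.toOneCochain (r k) (r l) (a ≫ homOfLE (hr k)) (b ≫ homOfLE (hr l))).1.1) =
      O'.endRes b.le (Z l).1) :
    (γ.refine W r hr).IsCohomologous (α.refine W r hr) := by
  -- `Zₖ` has degree `N - 1 ≥ 1` and is even, hence also has degree two; this covers `N = 2`.
  have hsq : ∀ k, (Z k).1 * (Z k).1 = 0 := fun k =>
    (mul_eq_zero_of_mem_filteredEnd hN (Z k).2.2.2
      (hO.mem_filteredEnd_two (Z k).2.2.1 (filteredEnd_antitone (by omega) (Z k).2.2.2))).1
  refine ⟨fun k => (⟨oneAddUnit (Z k).1 (hsq k),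
    oneAddUnit_mem_unipotent (by omega) (Z k).2 (hsq k)⟩ : O'.unipotent (W k)), fun k l T a b => ?_⟩
  have h := hZ k l T a b
  refine Subtype.ext (Units.ext ?_)
  change (1 + O'.endRes a.le (Z k).1) *
      (endEv γ.toOneCochain (r k) (r l) (a ≫ homOfLE (hr k)) (b ≫ homOfLE (hr l))).1.1 =
    (endEv α.toOneCochain (r k) (r l) (a ≫ homOfLE (hr k)) (b ≫ homOfLE (hr l))).1.1 *
      (1 + O'.endRes b.le (Z l).1)
  have h1 := (hO.mul_unipotent hN (O'.endRes_mem_evenDer a.le (Z k).2).2.2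
    (endEv γ.toOneCochain (r k) (r l) (a ≫ homOfLE (hr k)) (b ≫ homOfLE (hr l))).2).1
  have h2 := (hO.mul_unipotent hN (O'.endRes_mem_evenDer b.le (Z l).2).2.2
    (endEv α.toOneCochain (r k) (r l) (a ≫ homOfLE (hr k)) (b ≫ homOfLE (hr l))).2).2
  rw [add_mul, one_mul, h1, mul_add, mul_one, h2, ← h]
  abel

theorem isDetermined (hO : O'.IsOddGenerated) {N : ℕ} (hN : ∀ V, O'.filtration (N + 1) V = ⊥)
    {k : ℕ} (hk : O.IsNildominatedInDegree k)
    (hle : ∀ U, O'.filteredEnd U k ≤ O'.filteredEnd U ((N : ℤ) - 1))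
    (hH : Subsingleton (CechH1 (O'.derPresheaf ((N : ℤ) - 1)))) : A.IsDetermined := by
  refine ⟨A.isCompatible_cocycle, fun γ hγ => ?_⟩
  have hsub : ∀ i j, (A.value γ.toOneCochain i j).1 - (A.value A.cocycle.toOneCochain i j).1 ∈
      O'.evenDer ((N : ℤ) - 1) (A.U i ⊓ A.U j) := fun i j =>
    hO.sub_mem_evenDer hN (A.value_mem _ i j) (A.value_mem _ i j)
      (hle _ (hγ.value_sub_value_mem hO hN hk i j))
  have h : ∀ (i j : A.ι) (T : Opens X) (a : T ⟶ A.U i) (b : T ⟶ A.U j),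
      (endEv γ.toOneCochain i j a b).1.1 - (endEv A.cocycle.toOneCochain i j a b).1.1 ∈
        O'.evenDer ((N : ℤ) - 1) T := fun i j T a b => by
    rw [← endRes_value, ← endRes_value, ← map_sub]
    exact O'.endRes_mem_evenDer _ (hsub i j)
  rcases Nat.lt_or_ge N 2 with hN2 | hN2
  -- Here `N + 1 ≤ 2`, so deviations of degree two vanish and every unipotent automorphism is the
  -- identity.
  · have e : γ.toOneCochain = A.cocycle.toOneCochain := by
      refine PresheafOfGroups.OneCochain.ext (funext fun i => funext fun j => funext fun T =>
        funext fun a => funext fun b => ?_)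
      have h2 : (endEv γ.toOneCochain i j a b).1.1 - (endEv A.cocycle.toOneCochain i j a b).1.1 ∈
          O'.filteredEnd T 2 := by
        have := Submodule.sub_mem _
          (hO.sub_one_mem_filteredEnd_two (endEv γ.toOneCochain i j a b).2)
          (hO.sub_one_mem_filteredEnd_two (endEv A.cocycle.toOneCochain i j a b).2)
        rwa [sub_sub_sub_cancel_right] at this
      exact Subtype.ext (Units.ext (sub_eq_zero.1
        (eq_zero_of_mem_filteredEnd hN (by push_cast; omega) h2)))
    have e' : γ = A.cocycle := by
      cases γ
      cases h' : A.cocycle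
      simp only [h'] at e
      subst e
      rfl
    rw [e', cechClass]
  · have hmk : CechH1.mk A.isOpenCover (differenceCocycle hO hN γ A.cocycle h) =
        CechH1.mk A.isOpenCover 1 := Subsingleton.elim _ _
    -- The refinement map `t` belongs to the trivial cocycle and plays no role; `γ` and `α` are both
    -- refined along `r`.
    obtain ⟨κ, W, hW, r, hr, t, ht, Z, hZ⟩ := Quotient.exact hmk
    refine Quotient.sound ⟨κ, W, hW, r, hr, r, hr, isCohomologous_refine_of_sub_eq hO hN hN2 γ
      A.cocycle W r hr (fun k => Multiplicative.toAdd (Z k)) fun k l T a b => ?_⟩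
    exact (congrArg (fun D : O'.evenDer ((N : ℤ) - 1) T => D.1) (hZ k l a b)).trans
      (zero_add (O'.endRes b.le (Multiplicative.toAdd (Z l) : O'.evenDer ((N : ℤ) - 1) (W l)).1))

end SplittingAtlas

/-! ## Nilpotent elements of a finite-dimensional exterior algebra -/

section ExteriorAlgebra

variable {V : Type*} [AddCommGroup V] [Module ℂ V]

theorem ExteriorAlgebra.top_commute_range_ι :
    Commute (⊤ : Submodule ℂ (ExteriorAlgebra ℂ V)) (LinearMap.range (ExteriorAlgebra.ι ℂ)) := by
  have h : ⨆ i : ℕ, LinearMap.range (ExteriorAlgebra.ι ℂ (M := V)) ^ i = ⊤ :=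
    (DirectSum.Decomposition.isInternal (fun i : ℕ => ⋀[ℂ]^i V)).submodule_iSup_eq_top
  rw [Commute, SemiconjBy, ← h, Submodule.iSup_mul, Submodule.mul_iSup]
  simp only [← pow_succ, ← pow_succ']

theorem Submodule.mul_mem_top_mul {A : Type*} [Ring A] [Algebra ℂ A] {P : Submodule ℂ A}
    (hP : Commute ⊤ P) {a : A} (ha : a ∈ ⊤ * P) (b : A) : a * b ∈ ⊤ * P ∧ b * a ∈ ⊤ * P := by
  have h1 := Submodule.mul_mem_mul ha (Submodule.mem_top (R := ℂ) (x := b))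
  have h2 := Submodule.mul_mem_mul (Submodule.mem_top (R := ℂ) (x := b)) ha
  rw [mul_assoc, ← hP.eq, ← mul_assoc, Submodule.top_mul_top] at h1
  rw [← mul_assoc, Submodule.top_mul_top] at h2
  exact ⟨h1, h2⟩

/-- Every element is its scalar part modulo the ideal generated by `V`. For a nilpotent element the
scalar part is nilpotent in `ℂ`, hence zero, so the element lies in that ideal. -/
theorem ExteriorAlgebra.sub_algebraMapInv_mem (a : ExteriorAlgebra ℂ V) :
    a - algebraMap ℂ _ (ExteriorAlgebra.algebraMapInv a) ∈
      (⊤ : Submodule ℂ (ExteriorAlgebra ℂ V)) * LinearMap.range (ExteriorAlgebra.ι ℂ) := by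
  induction a using ExteriorAlgebra.induction with
  | algebraMap r => simp
  | ι x =>
    simpa [ExteriorAlgebra.algebraMapInv] using Submodule.mul_mem_mul (Submodule.mem_top (R := ℂ) (x := 1))
      (LinearMap.mem_range_self (ExteriorAlgebra.ι ℂ) x)
  | mul a b ha hb =>
    have e : a * b - algebraMap ℂ (ExteriorAlgebra ℂ V) (ExteriorAlgebra.algebraMapInv (a * b)) =
        (a - algebraMap ℂ _ (ExteriorAlgebra.algebraMapInv a)) * b +
        algebraMap ℂ _ (ExteriorAlgebra.algebraMapInv a) *
          (b - algebraMap ℂ _ (ExteriorAlgebra.algebraMapInv b)) := by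
      rw [map_mul, map_mul]
      noncomm_ring
    rw [e]
    exact add_mem (Submodule.mul_mem_top_mul top_commute_range_ι ha b).1
      (Submodule.mul_mem_top_mul top_commute_range_ι hb _).2
  | add a b ha hb =>
    rw [map_add, map_add, add_sub_add_comm]
    exact add_mem ha hb

theorem ExteriorAlgebra.mem_of_isNilpotent {a : ExteriorAlgebra ℂ V} (ha : IsNilpotent a) :
    a ∈ (⊤ : Submodule ℂ (ExteriorAlgebra ℂ V)) * LinearMap.range (ExteriorAlgebra.ι ℂ) := by
  simpa [(ha.map ExteriorAlgebra.algebraMapInv).eq_zero] using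
    ExteriorAlgebra.sub_algebraMapInv_mem a

theorem ExteriorAlgebra.top_mul_range_ι_pow_eq_bot [FiniteDimensional ℂ V] {n : ℕ}
    (hn : Module.finrank ℂ V < n) :
    ((⊤ : Submodule ℂ (ExteriorAlgebra ℂ V)) * LinearMap.range (ExteriorAlgebra.ι ℂ)) ^ n = ⊥ := by
  have h : LinearMap.range (ExteriorAlgebra.ι ℂ (M := V)) ^ n = ⊥ := by
    refine Submodule.finrank_eq_zero.1 ((exteriorPower.finrank_eq ℂ n).trans ?_)
    exact Nat.choose_eq_zero_of_lt hn
  rw [top_commute_range_ι.mul_pow, h, Submodule.mul_bot]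

/-- The determinant of the basis extends to a linear form on the exterior algebra with value `1` on
this product. -/
theorem ExteriorAlgebra.prod_ofFn_ι_basis_ne_zero {n : ℕ} (b : Module.Basis (Fin n) ℂ V) :
    (List.ofFn fun i => ExteriorAlgebra.ι ℂ (b i)).prod ≠ 0 := by
  intro h
  rw [← ExteriorAlgebra.ιMulti_apply] at h
  have h' := congrArg (ExteriorAlgebra.liftAlternating (R := ℂ) (Pi.single n b.det)) h
  rw [ExteriorAlgebra.liftAlternating_apply_ιMulti, Pi.single_eq_same, b.det_self, map_zero] at h'
  exact one_ne_zero h'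

end ExteriorAlgebra

theorem Submodule.list_prod_mem_pow {A : Type*} [Ring A] [Algebra ℂ A] (P : Submodule ℂ A)
    (l : List A) (hl : ∀ a ∈ l, a ∈ P) : l.prod ∈ P ^ l.length := by
  induction l with
  | nil => simpa using Submodule.one_le.1 (le_refl (1 : Submodule ℂ A))
  | cons a l ih =>
    rw [List.prod_cons, List.length_cons, pow_succ']
    exact Submodule.mul_mem_mul (hl a (by simp)) (ih fun b hb => hl b (by simp [hb]))

/-! ## The sheaf of sections of an exterior bundle -/

section ExteriorSheaf

open SuperalgebraSheaf

variable (B : Type*) [NormedAddCommGroup B] [NormedSpace ℂ B]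
  {M : Type u} [TopologicalSpace M] [ChartedSpace B M]
  (F : Type*) [NormedAddCommGroup F] [NormedSpace ℂ F]
  (E : M → Type v) [TopologicalSpace (TotalSpace F E)] [∀ x, AddCommGroup (E x)]
  [∀ x, Module ℂ (E x)] [∀ x, TopologicalSpace (E x)] [FiberBundle F E]

/-- The value of a section of `ΛE` at a point. -/
noncomputable def exteriorSheafEval {U : Opens M} (x : U) :
    (exteriorSheaf B F E).Sec U →ₐ[ℂ] ExteriorAlgebra ℂ (E x) :=
  (Pi.evalAlgHom ℂ (fun x : U => ExteriorAlgebra ℂ (E x)) x).comp (exteriorSections B F E U).val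

theorem exteriorSheaf_ext {U : Opens M} {s t : (exteriorSheaf B F E).Sec U}
    (h : ∀ x : U, exteriorSheafEval B F E x s = exteriorSheafEval B F E x t) : s = t :=
  Subtype.ext (funext h)

/-- The inclusion of the sections of the sheaf `𝒪_{ΛE}` into all sections of `ΛE`. -/
noncomputable def exteriorSheafVal (U : Opens M) :
    (exteriorSheaf B F E).Sec U →ₐ[ℂ] AllSections E U :=
  (exteriorSections B F E U).val

/-- A generator of the algebra of sections, as a section of the sheaf `𝒪_{ΛE}`. -/
def exteriorSheafGenerator {U : Opens M} {s : AllSections E U}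
    (hs : s ∈ exteriorGenerators B F E U) : (exteriorSheaf B F E).Sec U :=
  (⟨s, fun _ hx => ⟨U, le_rfl, hx, Algebra.subset_adjoin hs⟩⟩ : exteriorSections B F E U)

theorem SuperalgebraSheaf.algHom_apply_eq_zero {X : TopCat.{u}} (O : SuperalgebraSheaf.{u, v} X)
    {U : Opens X} (χ : O.Sec U →ₐ[ℂ] ℂ) {s : O.Sec U}
    (hs : s ∈ (⊤ : Submodule ℂ (O.Sec U)) * O.parity U 1) : χ s = 0 := by
  have h : (⊤ : Submodule ℂ (O.Sec U)) * O.parity U 1 ≤ LinearMap.ker χ.toLinearMap := by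
    refine Submodule.mul_le.2 fun a _ b hb => ?_
    change χ (a * b) = 0
    rw [map_mul, ((O.isNilpotent_of_odd hb).map χ).eq_zero, mul_zero]
  exact h hs

/-- The sections of `ΛE` which are, up to the ideal generated by the odd sections, given by
functions. -/
noncomputable def functionsAddOdd (U : Opens M) : Subalgebra ℂ ((exteriorSheaf B F E).Sec U) where
  carrier := {s | ∃ q : (exteriorSheaf B F E).Sec U,
    (∀ x : U, ∃ c : ℂ, exteriorSheafEval B F E x q = algebraMap ℂ _ c) ∧
    s - q ∈ (⊤ : Submodule ℂ ((exteriorSheaf B F E).Sec U)) * (exteriorSheaf B F E).parity U 1}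
  mul_mem' := by
    rintro s s' ⟨q, hq, hs⟩ ⟨q', hq', hs'⟩
    refine ⟨q * q', fun x => ?_, ?_⟩
    · obtain ⟨c, hc⟩ := hq x
      obtain ⟨c', hc'⟩ := hq' x
      exact ⟨c * c', by rw [map_mul, hc, hc', map_mul]⟩
    · have e : s * s' - q * q' = (s - q) * s' + q * (s' - q') := by noncomm_ring
      rw [e]
      exact add_mem (Submodule.mul_mem_top_mul ((exteriorSheaf B F E).top_commute_odd U) hs s').1
        (Submodule.mul_mem_top_mul ((exteriorSheaf B F E).top_commute_odd U) hs' q).2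
  add_mem' := by
    rintro s s' ⟨q, hq, hs⟩ ⟨q', hq', hs'⟩
    refine ⟨q + q', fun x => ?_, ?_⟩
    · obtain ⟨c, hc⟩ := hq x
      obtain ⟨c', hc'⟩ := hq' x
      exact ⟨c + c', by rw [map_add, hc, hc', map_add]⟩
    · rw [add_sub_add_comm]
      exact add_mem hs hs'
  algebraMap_mem' c := ⟨algebraMap ℂ _ c, fun x => ⟨c, AlgHom.commutes _ _⟩, by
    rw [sub_self]
    exact Submodule.zero_mem _⟩

theorem adjoin_exteriorGenerators_le (U : Opens M) :
    Algebra.adjoin ℂ (exteriorGenerators B F E U) ≤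
      (functionsAddOdd B F E U).map (exteriorSheafVal B F E U) := by
  refine Algebra.adjoin_le fun s hs => ⟨exteriorSheafGenerator B F E hs, ?_, rfl⟩
  rcases id hs with ⟨f, hf, rfl⟩ | ⟨σ, hσ, rfl⟩
  · refine ⟨exteriorSheafGenerator B F E hs, fun x => ⟨f x, rfl⟩, ?_⟩
    rw [sub_self]
    exact Submodule.zero_mem _
  · refine ⟨0, fun x => ⟨0, by rw [map_zero, map_zero]⟩, ?_⟩
    rw [sub_zero]
    have h : exteriorSheafGenerator B F E hs ∈ (exteriorSheaf B F E).parity U 1 :=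
      fun x _ => CliffordAlgebra.ι_mem_evenOdd_one _ _
    simpa using Submodule.mul_mem_mul (Submodule.mem_top (R := ℂ) (x := 1)) h

/-- Locally a section is a function `q` modulo the ideal generated by odd sections. The scalar part
at a point is a character, which kills nilpotent and odd sections alike; so for a nilpotent section
`q` vanishes at every point. -/
theorem exteriorSheaf_isOddGenerated : (exteriorSheaf B F E).IsOddGenerated := by
  intro U f hf x hx
  obtain ⟨V, hV, hxV, hfV⟩ := f.2 x hx
  refine ⟨V, hV, hxV, ?_⟩
  obtain ⟨s, ⟨q, hq, hs⟩, hsf⟩ := adjoin_exteriorGenerators_le B F E V hfV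
  have e : s = (exteriorSheaf B F E).res hV f := Subtype.ext hsf
  have hs' : IsNilpotent s := e ▸ hf.map ((exteriorSheaf B F E).res hV)
  have hq0 : q = 0 := by
    refine exteriorSheaf_ext B F E fun y => ?_
    obtain ⟨c, hc⟩ := hq y
    let χ : (exteriorSheaf B F E).Sec V →ₐ[ℂ] ℂ :=
      ExteriorAlgebra.algebraMapInv.comp (exteriorSheafEval B F E y)
    have h1 : χ (s - q) = 0 := algHom_apply_eq_zero _ χ hs
    have h2 : χ q = c := by
      change ExteriorAlgebra.algebraMapInv (exteriorSheafEval B F E y q) = c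
      rw [hc, AlgHom.commutes]
      rfl
    rw [map_sub, (hs'.map χ).eq_zero, zero_sub, neg_eq_zero, h2] at h1
    rw [hc, h1, map_zero, map_zero]
  rw [hq0, sub_zero, e] at hs
  exact hs

/-- Evaluation at `x` sends nilpotent sections into the ideal of `ΛEₓ` generated by `Eₓ`, whose
`n`-th power is zero once `n` exceeds the rank. -/
theorem exteriorSheaf_filtration_eq_bot [FiniteDimensional ℂ F] [VectorBundle ℂ F E] {n : ℕ}
    (hn : Module.finrank ℂ F < n) (U : Opens M) : (exteriorSheaf B F E).filtration n U = ⊥ := by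
  refine eq_bot_iff.2 fun f hf => (Submodule.mem_bot ℂ).2 (exteriorSheaf_ext B F E fun x => ?_)
  obtain ⟨V, hV, hxV, hfV⟩ := hf x.1 x.2
  let b := (trivializationAt F E x.1).basisAt (Module.finBasis ℂ F)
    (FiberBundle.mem_baseSet_trivializationAt F E x.1)
  have : FiniteDimensional ℂ (E x.1) := b.finiteDimensional_of_finite
  have hrank : Module.finrank ℂ (E x.1) < n := by
    rwa [Module.finrank_eq_card_basis b, Fintype.card_fin]
  let χ := exteriorSheafEval B F E (⟨x.1, hxV⟩ : V)
  have h : χ ((exteriorSheaf B F E).res hV f) ∈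
      ((⊤ : Submodule ℂ ((exteriorSheaf B F E).Sec V)) *
        (exteriorSheaf B F E).nil V ^ n).map χ.toLinearMap := ⟨_, hfV, rfl⟩
  rw [Submodule.map_mul, Submodule.map_pow] at h
  have h' : χ ((exteriorSheaf B F E).res hV f) ∈ (⊤ : Submodule ℂ (ExteriorAlgebra ℂ (E x.1))) *
      ((⊤ : Submodule ℂ (ExteriorAlgebra ℂ (E x.1))) *
        LinearMap.range (ExteriorAlgebra.ι ℂ)) ^ n := by
    refine Submodule.mem_mul_of_le le_top (pow_le_pow_left' ?_ n) h
    rw [nil, Submodule.map_span_le]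
    exact fun a ha => ExteriorAlgebra.mem_of_isNilpotent (IsNilpotent.map (r := a) ha χ)
  rw [ExteriorAlgebra.top_mul_range_ι_pow_eq_bot hrank, Submodule.mul_bot, Submodule.mem_bot] at h'
  rw [map_zero]
  exact h'

/-- The section is the exterior product of a local holomorphic frame; it is nonzero at `x`, where
the frame is a basis of `Eₓ`. -/
theorem exists_ne_zero_mem_filtration [FiniteDimensional ℂ F] [VectorBundle ℂ F E]
    [ContMDiffVectorBundle ω F E 𝓘(ℂ, B)] (x : M) {U : Opens M} (hx : x ∈ U)
    (hU : (U : Set M) ⊆ (trivializationAt F E x).baseSet) :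
    ∃ s ∈ (exteriorSheaf B F E).filtration (Module.finrank ℂ F) U, s ≠ 0 := by
  let e := trivializationAt F E x
  let b := Module.finBasis ℂ F
  have hg : ∀ i, (fun y : U => ExteriorAlgebra.ι ℂ (e.localFrame b i y)) ∈
      exteriorGenerators B F E U := fun i =>
    Or.inr ⟨e.localFrame b i, (e.contMDiffOn_localFrame_baseSet ω b i).mono hU, rfl⟩
  let s : Fin (Module.finrank ℂ F) → (exteriorSheaf B F E).Sec U := fun i =>
    exteriorSheafGenerator B F E (hg i)
  have hs : ∀ i, s i ∈ (exteriorSheaf B F E).nil U := fun i =>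
    (exteriorSheaf B F E).odd_le_nil U
      (show s i ∈ (exteriorSheaf B F E).parity U 1 from
        fun y _ => CliffordAlgebra.ι_mem_evenOdd_one _ _)
  refine ⟨(List.ofFn s).prod, fun y hy => ⟨U, le_rfl, hy, ?_⟩, fun h => ?_⟩
  · have h := Submodule.list_prod_mem_pow _ (List.ofFn s) (by
      intro a ha
      obtain ⟨i, rfl⟩ := List.mem_ofFn.1 ha
      exact hs i)
    rw [List.length_ofFn] at h
    rw [res_self]
    simpa using Submodule.mul_mem_mul (Submodule.mem_top (R := ℂ) (x := 1)) h
  · have h' := congrArg (exteriorSheafEval B F E ⟨x, hx⟩) h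
    rw [map_list_prod, map_zero, List.map_ofFn] at h'
    refine ExteriorAlgebra.prod_ofFn_ι_basis_ne_zero (e.basisAt b (hU hx)) ?_
    rw [← h']
    congr 2
    funext i
    exact congrArg _ (e.localFrame_apply_of_mem_baseSet b (hU hx)).symm

variable {B} {F} {E}

/-- The filtration is defined by nilpotent elements alone, so isomorphisms preserve it. Near a point
both local models of `S` are available: one has a nonzero section in degree `rk E`, while the other
has none in degrees above the odd dimension. -/
theorem SplittingAtlas.finrank_le_oddDim [FiniteDimensional ℂ F] [VectorBundle ℂ F E]
    [ContMDiffVectorBundle ω F E 𝓘(ℂ, B)] [Nonempty M] {S : ComplexSupermanifold.{u, w} B M}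
    (A : SplittingAtlas S.toSuperalgebraSheaf (exteriorSheaf B F E)) :
    Module.finrank ℂ F ≤ S.oddDim := by
  obtain ⟨x⟩ := ‹Nonempty M›
  obtain ⟨i, hi⟩ := A.isOpenCover.exists_mem x
  obtain ⟨U', hxU', ⟨ψ⟩⟩ := S.locally_split x
  let T : Opens M := A.U i ⊓ U' ⊓
    ⟨(trivializationAt F E x).baseSet, (trivializationAt F E x).open_baseSet⟩
  have hTi : T ≤ A.U i := inf_le_left.trans inf_le_left
  have hTU' : T ≤ U' := inf_le_left.trans inf_le_right
  have hT : (T : Set M) ⊆ (trivializationAt F E x).baseSet := fun _ hy => hy.2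
  obtain ⟨s, hs, hs0⟩ := exists_ne_zero_mem_filtration B F E x (U := T)
    ⟨⟨hi, hxU'⟩, FiberBundle.mem_baseSet_trivializationAt F E x⟩ hT
  by_contra! hlt
  have h := ψ.equiv_mem_filtration ⟨T, hTU'⟩ _
    ((A.chart i).symm.equiv_mem_filtration ⟨T, hTi⟩ _ hs)
  rw [exteriorSheaf_filtration_eq_bot B (EuclideanSpace ℂ (Fin S.oddDim)) _
    (by rwa [finrank_euclideanSpace_fin]), Submodule.mem_bot,
    map_eq_zero_iff _ (ψ.equiv ⟨T, hTU'⟩).injective] at h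
  exact hs0 ((map_eq_zero_iff _ ((A.chart i).symm.equiv ⟨T, hTi⟩).injective).1 h)

end ExteriorSheaf


/-- Let `S` be a complex supermanifold on the complex manifold `M`, represented through local
splittings (`A`) by a cocycle `α` with values in `G_E`. -/
theorem proposition007
    {B : Type*} [NormedAddCommGroup B] [NormedSpace ℂ B] [FiniteDimensional ℂ B]
    {M : Type u} [TopologicalSpace M] [ChartedSpace B M] [IsManifold 𝓘(ℂ, B) ω M]
    (F : Type*) [NormedAddCommGroup F] [NormedSpace ℂ F] [FiniteDimensional ℂ F]
    (E : M → Type v) [TopologicalSpace (TotalSpace F E)] [∀ x, AddCommGroup (E x)]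
    [∀ x, Module ℂ (E x)] [∀ x, TopologicalSpace (E x)] [FiberBundle F E] [VectorBundle ℂ F E]
    [ContMDiffVectorBundle ω F E 𝓘(ℂ, B)]
    (S : ComplexSupermanifold.{u, w} B M)
    (A : SplittingAtlas S.toSuperalgebraSheaf (exteriorSheaf B F E)) :
    (∀ s : ℕ, S.IsNildominatedInDegree (2 * s) → A.IsDeterminedUpTo (2 * s)) ∧
    (S.IsNildominated →
      Subsingleton (CechH1 ((exteriorSheaf B F E).derPresheaf ((Module.finrank ℂ F : ℤ) - 1))) →
      A.IsDetermined) := by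
  have hO := exteriorSheaf_isOddGenerated B F E
  have hN := fun V => exteriorSheaf_filtration_eq_bot B F E (Nat.lt_succ_self _) V
  refine ⟨fun s hs => SplittingAtlas.isDeterminedUpTo hO hN hs, fun ⟨s, hs, hnil⟩ hH =>
    SplittingAtlas.isDetermined hO hN hnil (fun U => ?_) hH⟩
  -- It remains to see that `N - 1 ≤ 2s`, from `N ≤ oddDim ≤ 2s + 1`. The rank comparison needs a
  -- point; on empty `M` membership in the filtration is vacuous.
  rcases isEmpty_or_nonempty M with hM | hM
  · exact fun _ _ _ _ _ _ x _ => isEmptyElim x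
  · have := A.finrank_le_oddDim
    exact SuperalgebraSheaf.filteredEnd_antitone (by push_cast; omega)
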